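/- There are absolute constants $C>0$ and $k\in\mathbb N$ such that the following holds for every integer $N\ge 1$, every (known) probability distribution $\mathcal D^*$ on $[N]=\{1,\dots,N\}$ and every $\varepsilon>0$. There is a randomized adaptive algorithm (which may depend on $N$, $\mathcal D^*$ and $\varepsilon$) with access to an unknown distribution $\mathcal D$ on $[N]$ only through two oracles, each answering every call with fresh, independent randomness: $\mathrm{Samp}$, which returns an element $i\in[N]$ with probability $D(i)$, and $\mathrm{Pcond}(x,y)$ for distinct $x,y\in[N]$ with $D(x)+D(y)>0$, which returns $x$ with probability $\frac{D(x)}{D(x)+D(y)}$ and $y$ with probability $\frac{D(y)}{D(x)+D(y)}$. For every distribution $\mathcal D$ on $[N]$: if $\mathcal D=\mathcal D^*$, the algorithm outputs ACCEPT with probability at least $2/3$; and if $d_{\mathrm{TV}}(\mathcal D,\mathcal D^*)=\frac12\sum_{i=1}^N|D(i)-D^*(i)|\ge\varepsilon$, it outputs REJECT with probability at least $2/3$. (Runs that call $\mathrm{Pcond}(x,y)$ with $D(x)+D(y)=0$ count neither as accepting nor as rejecting.) Moreover, the algorithm always makes at most $\tilde O(\sqrt{\log N}\cdot\varepsilon^{-2})$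 oracle queries in total, that is, at most $C\,f\,\bigl(\log(2+f)\bigr)^k$ queries, where $f=\sqrt{\log N}\cdot\varepsilon^{-2}$. -/

import Mathlib

/-- Total variation distance between two distributions on `Fin N`, given by their
probability vectors. -/
noncomputable def tvDist {N : ℕ} (D₁ D₂ : Fin N → ℝ) : ℝ :=
  (1 / 2) * ∑ i, |D₁ i - D₂ i|

/-- A randomized adaptive query algorithm in the PAIRCOND model over an `N`-element domain,
with a yes/no answer, as a decision tree. The next step may depend on all previous oracle
answers and on all internal randomness. -/
inductive PaircondAlg (N : ℕ) : Type
  /-- Stop and answer: `true` is ACCEPT, `false` is REJECT. -/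
  | output (b : Bool) : PaircondAlg N
  /-- Internal randomness (no oracle query): draw a uniform element of an `(m+1)`-element set. -/
  | rand (m : ℕ) (next : Fin (m + 1) → PaircondAlg N) : PaircondAlg N
  /-- Query SAMP and continue according to the element drawn. -/
  | samp (next : Fin N → PaircondAlg N) : PaircondAlg N
  /-- Query PCOND on two distinct elements `x`, `y`; continue with `ifx` if the oracle
  returns `x`, and with `ify` if it returns `y`. -/
  | pcond (x y : Fin N) (hxy : x ≠ y) (ifx ify : PaircondAlg N) : PaircondAlg N

namespace PaircondAlg

/-- The worst-case number of oracle queries (SAMP and PCOND together): the maximum over all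
oracle answers and all internal random choices. -/
def queries {N : ℕ} : PaircondAlg N → ℕ
  | output _ => 0
  | rand _ next => Finset.univ.sup fun i => (next i).queries
  | samp next => 1 + Finset.univ.sup fun i => (next i).queries
  | pcond _ _ _ ifx ify => 1 + max ifx.queries ify.queries

/-- The probability that the algorithm answers `b` when its oracles are those of the
distribution `D`; every oracle answer is drawn afresh, independently of the past.

PCOND on a pair with `D x + D y = 0` has no meaning. By `0 / 0 = 0` both terms of the last
case then vanish: a run that makes such a query counts neither as accepting nor as rejecting,
so a guarantee on these probabilities holds however such queries are answered. -/
noncomputable def outProb {N : ℕ} (D : Fin N → ℝ) : PaircondAlg N → Bool → ℝ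
  | output b', b => if b' = b then 1 else 0
  | rand m next, b => (∑ i, (next i).outProb D b) / ((m : ℝ) + 1)
  | samp next, b => ∑ i, D i * (next i).outProb D b
  | pcond x y _ ifx ify, b =>
      D x / (D x + D y) * ifx.outProb D b + D y / (D x + D y) * ify.outProb D b

end PaircondAlg

/-! Cut the domain into `K + 1` cells according to the dyadic size of `D*`, with K about log N +
log(1/ε). The last cell holds the light elements, of total `D*`-mass at most ε/16. A distribution
far from `D*` must then either give the cells the wrong masses or look wrong inside some cell.

The masses are checked with samples alone (`exists_cellTest`). This is identity testing on a domain
of size K + 1, and a chi-square type statistic does it with O(√K / ε²) samples. Its two factors come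
from independent batches, so it is an unbiased estimate of a weighted squared distance, and
Chebyshev's inequality suffices.

Inside a cell `D*` varies by a factor at most two, so comparing a sample x with a uniform y of its
cell is informative. By symmetrization (`sum_abs_sub_le_sum_pcondDev`) the mean deviation between
the Pcond laws of `D` and `D*` bounds the l¹ distance in the cell, up to the error in its mass.
Together these give a mean deviation of order ε in the remaining far case. The dyadic pigeonhole
`exists_pairMean_level_ge` finds a scale 2^(-j) at which deviations are frequent enough. Trying
every scale, with few pairs and many queries per pair for small deviations and the reverse for large
ones, costs ε^(-2) up to logarithms (`scalesTest`).

The log(1/ε) inside √K and the powers of L are absorbed by the logarithmic factor in `query_bound`.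
-/

namespace PaircondAlg

/-! ### Sequential composition of algorithms. -/

variable {N : ℕ}

/-- Run `A`; if it accepts, run `B` with fresh randomness. -/
def seq : PaircondAlg N → PaircondAlg N → PaircondAlg N
  | output true, B => B
  | output false, _ => output false
  | rand m next, B => rand m fun i => (next i).seq B
  | samp next, B => samp fun i => (next i).seq B
  | pcond x y h a b, B => pcond x y h (a.seq B) (b.seq B)

theorem outProb_seq_true (D : Fin N → ℝ) (A B : PaircondAlg N) :
    (A.seq B).outProb D true = A.outProb D true * B.outProb D true := by
  induction A with
  | output b => cases b <;> simp [seq, outProb]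
  | rand m next ih => simp [seq, outProb, ih, ← Finset.sum_mul]; ring
  | samp next ih => simp [seq, outProb, ih, Finset.sum_mul, mul_assoc]
  | pcond x y h a b iha ihb => simp [seq, outProb, iha, ihb]; ring

theorem outProb_seq_false (D : Fin N → ℝ) (A B : PaircondAlg N) :
    (A.seq B).outProb D false
      = A.outProb D false + A.outProb D true * B.outProb D false := by
  induction A with
  | output b => cases b <;> simp [seq, outProb]
  | rand m next ih =>
    simp [seq, outProb, ih, Finset.sum_add_distrib, ← Finset.sum_mul]; ring
  | samp next ih =>
    simp [seq, outProb, ih, mul_add, Finset.sum_add_distrib, Finset.sum_mul, mul_assoc]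
  | pcond x y h a b iha ihb => simp [seq, outProb, iha, ihb]; ring

theorem queries_seq_le (A B : PaircondAlg N) :
    (A.seq B).queries ≤ A.queries + B.queries := by
  induction A with
  | output b => cases b <;> simp [seq, queries]
  | rand m next ih =>
    simp only [seq, queries]
    refine Finset.sup_le fun i hi => (ih i).trans ?_
    gcongr
    exact Finset.le_sup (f := fun i => (next i).queries) hi
  | samp next ih =>
    simp only [seq, queries, add_assoc]
    refine Nat.add_le_add_left (Finset.sup_le fun i hi => (ih i).trans ?_) 1
    gcongr
    exact Finset.le_sup (f := fun i => (next i).queries) hi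
  | pcond x y h a b iha ihb => simp only [seq, queries]; omega

/-- Every run of the algorithm on the distribution `D` gives an answer. -/
def IsProper (D : Fin N → ℝ) (A : PaircondAlg N) : Prop :=
  A.outProb D true + A.outProb D false = 1

theorem IsProper.output (D : Fin N → ℝ) (b : Bool) :
    IsProper D (output b : PaircondAlg N) := by
  cases b <;> simp [IsProper, outProb]

theorem IsProper.seq {D : Fin N → ℝ} {A B : PaircondAlg N} (hA : IsProper D A)
    (hB : IsProper D B) : IsProper D (A.seq B) := by
  unfold IsProper at *
  rw [outProb_seq_true, outProb_seq_false]
  linear_combination hA + A.outProb D true * hB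

theorem IsProper.rand {D : Fin N → ℝ} {m : ℕ} {next : Fin (m + 1) → PaircondAlg N}
    (h : ∀ i, IsProper D (next i)) : IsProper D (rand m next) := by
  unfold IsProper at *
  simp only [outProb]
  rw [← add_div, ← Finset.sum_add_distrib, Finset.sum_congr rfl fun i _ => h i]
  have : (m : ℝ) + 1 ≠ 0 := by positivity
  simp [this]

/-- Only elements of positive mass matter after a sample. This makes later Pcond calls legitimate:
one of the two elements is always a sample. -/
theorem IsProper.samp {D : Fin N → ℝ} (hD : D ∈ stdSimplex ℝ (Fin N))
    {next : Fin N → PaircondAlg N} (h : ∀ i, 0 < D i → IsProper D (next i)) :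
    IsProper D (samp next) := by
  unfold IsProper at *
  simp only [outProb]
  rw [← Finset.sum_add_distrib, ← hD.2]
  refine Finset.sum_congr rfl fun i _ => ?_
  rcases (hD.1 i).eq_or_lt with h0 | h0
  · simp [← h0]
  · rw [← mul_add, h i h0, mul_one]

theorem IsProper.pcond {D : Fin N → ℝ} {x y : Fin N} (hxy : x ≠ y) (hD : D x + D y ≠ 0)
    {a b : PaircondAlg N} (ha : IsProper D a) (hb : IsProper D b) :
    IsProper D (pcond x y hxy a b) := by
  unfold IsProper at *
  simp only [outProb]
  have : D x / (D x + D y) + D y / (D x + D y) = 1 := by rw [← add_div, div_self hD]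
  linear_combination D x / (D x + D y) * ha + D y / (D x + D y) * hb + this

theorem outProb_nonneg {D : Fin N → ℝ} (hD : ∀ i, 0 ≤ D i) (A : PaircondAlg N) (b : Bool) :
    0 ≤ A.outProb D b := by
  induction A with
  | output b' => simp only [outProb]; split_ifs <;> norm_num
  | rand m next ih =>
    exact div_nonneg (Finset.sum_nonneg fun i _ => ih i) (by positivity)
  | samp next ih => exact Finset.sum_nonneg fun i _ => mul_nonneg (hD i) (ih i)
  | pcond x y h a b iha ihb =>
    have := hD x
    have := hD y
    simp only [outProb]
    positivity

theorem IsProper.le_one {D : Fin N → ℝ} (hD : ∀ i, 0 ≤ D i) {A : PaircondAlg N}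
    (hA : IsProper D A) (b : Bool) : A.outProb D b ≤ 1 := by
  have h1 := outProb_nonneg hD A true
  have h2 := outProb_nonneg hD A false
  unfold IsProper at hA
  cases b <;> linarith

/-- Run `F 0, …, F (n - 1)` one after the other, accepting if all of them accept. -/
def seqRange (F : ℕ → PaircondAlg N) : ℕ → PaircondAlg N
  | 0 => output true
  | n + 1 => (seqRange F n).seq (F n)

theorem outProb_seqRange_true (D : Fin N → ℝ) (F : ℕ → PaircondAlg N) (n : ℕ) :
    (seqRange F n).outProb D true = ∏ i ∈ Finset.range n, (F i).outProb D true := by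
  induction n with
  | zero => simp [seqRange, outProb]
  | succ n ih => rw [seqRange, outProb_seq_true, ih, Finset.prod_range_succ]

theorem queries_seqRange_le (F : ℕ → PaircondAlg N) (n : ℕ) :
    (seqRange F n).queries ≤ ∑ i ∈ Finset.range n, (F i).queries := by
  induction n with
  | zero => simp [seqRange, queries]
  | succ n ih =>
    rw [seqRange, Finset.sum_range_succ]
    exact (queries_seq_le _ _).trans (by gcongr)

theorem IsProper.seqRange {D : Fin N → ℝ} {F : ℕ → PaircondAlg N} (h : ∀ i, IsProper D (F i))
    (n : ℕ) : IsProper D (seqRange F n) := by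
  induction n with
  | zero => exact IsProper.output D true
  | succ n ih => exact ih.seq (h n)

end PaircondAlg

/-! ### Moments and tails of sums of independent variables. -/

/-- The expectation of `g (f X₁ + ⋯ + f Xₙ)` for independent `Xᵢ` with weights `w`. -/
def iidSum {ι V : Type*} [Fintype ι] [AddCommMonoid V] (w : ι → ℝ) (f : ι → V) :
    ℕ → (V → ℝ) → ℝ
  | 0, g => g 0
  | n + 1, g => ∑ i, w i * iidSum w f n fun v => g (f i + v)

section iidSum

variable {ι V W : Type*} [Fintype ι] [AddCommMonoid V] [AddCommMonoid W] {w : ι → ℝ}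

theorem iidSum_mono (hw : ∀ i, 0 ≤ w i) (f : ι → V) (n : ℕ) {g h : V → ℝ} (hgh : ∀ v, g v ≤ h v) :
    iidSum w f n g ≤ iidSum w f n h := by
  induction n generalizing g h with
  | zero => exact hgh 0
  | succ n ih =>
    exact Finset.sum_le_sum fun i _ =>
      mul_le_mul_of_nonneg_left (ih fun v => hgh _) (hw i)

theorem iidSum_add (w : ι → ℝ) (f : ι → V) (n : ℕ) (g h : V → ℝ) :
    iidSum w f n (fun v => g v + h v) = iidSum w f n g + iidSum w f n h := by
  induction n generalizing g h with
  | zero => rfl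
  | succ n ih => simp only [iidSum, ih, mul_add, Finset.sum_add_distrib]

theorem iidSum_const_mul (w : ι → ℝ) (f : ι → V) (n : ℕ) (c : ℝ) (g : V → ℝ) :
    iidSum w f n (fun v => c * g v) = c * iidSum w f n g := by
  induction n generalizing g with
  | zero => rfl
  | succ n ih => simp only [iidSum, ih, Finset.mul_sum, mul_left_comm]

theorem iidSum_sum (w : ι → ℝ) (f : ι → V) (n : ℕ) {κ : Type*} (s : Finset κ)
    (g : κ → V → ℝ) :
    iidSum w f n (fun v => ∑ k ∈ s, g k v) = ∑ k ∈ s, iidSum w f n (g k) := by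
  classical
  induction s using Finset.induction_on with
  | empty => simpa using iidSum_const_mul w f n 0 (fun _ => 0)
  | insert a s ha ih => simp only [Finset.sum_insert ha, iidSum_add, ih]

theorem iidSum_comp (w : ι → ℝ) (f : ι → V) (φ : V →+ W) (n : ℕ) (g : W → ℝ) :
    iidSum w f n (fun v => g (φ v)) = iidSum w (fun i => φ (f i)) n g := by
  induction n generalizing g with
  | zero => simp [iidSum]
  | succ n ih =>
    simp only [iidSum, map_add]
    exact Finset.sum_congr rfl fun i _ => by rw [ih fun u => g (φ (f i) + u)]

theorem iidSum_exp (w f : ι → ℝ) (n : ℕ) (l : ℝ) :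
    iidSum w f n (fun v => Real.exp (l * v)) = (∑ i, w i * Real.exp (l * f i)) ^ n := by
  induction n with
  | zero => simp [iidSum]
  | succ n ih =>
    simp only [iidSum, mul_add, Real.exp_add, iidSum_const_mul, ih, pow_succ', Finset.sum_mul,
      mul_assoc]

/-- Bias-variance decomposition for a sum of independent variables. -/
theorem iidSum_sub_sq_le (hw0 : ∀ i, 0 ≤ w i) (hw : ∑ i, w i = 1) (f : ι → ℝ) (n : ℕ) (a c : ℝ) :
    iidSum w f n (fun v => (v - c) ^ 2)
      ≤ n * ∑ i, w i * (f i - a) ^ 2 + (n * ∑ i, w i * f i - c) ^ 2 := by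
  induction n generalizing c with
  | zero => simp [iidSum]
  | succ n ih =>
    set m := ∑ i, w i * f i with hm
    set S := ∑ i, w i * (f i - a) ^ 2 with hS
    have key : ∀ i, iidSum w f n (fun v => (f i + v - c) ^ 2)
        ≤ n * S + (n * m - (c - f i)) ^ 2 := by
      intro i
      have := ih (c - f i)
      simpa only [show ∀ v : ℝ, f i + v - c = v - (c - f i) from fun v => by ring] using this
    have h1 : ∑ i, w i * f i ^ 2 = S + 2 * a * m - a ^ 2 := by
      have : S = ∑ i, w i * f i ^ 2 - 2 * a * m + a ^ 2 * ∑ i, w i := by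
        rw [hS, hm, Finset.mul_sum, Finset.mul_sum, ← Finset.sum_sub_distrib,
          ← Finset.sum_add_distrib]
        exact Finset.sum_congr rfl fun i _ => by ring
      rw [this, hw]; ring
    calc iidSum w f (n + 1) (fun v => (v - c) ^ 2)
        ≤ ∑ i, w i * (n * S + (n * m - (c - f i)) ^ 2) :=
          Finset.sum_le_sum fun i _ => mul_le_mul_of_nonneg_left (key i) (hw0 i)
      _ = (n * S + (n * m - c) ^ 2) * ∑ i, w i + 2 * (n * m - c) * m + ∑ i, w i * f i ^ 2 := by
          have expand : ∀ X Y : ℝ, ∑ i, w i * (X + (Y - (c - f i)) ^ 2)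
              = (X + (Y - c) ^ 2) * ∑ i, w i + 2 * (Y - c) * ∑ i, w i * f i
                + ∑ i, w i * f i ^ 2 := by
            intro X Y
            rw [Finset.mul_sum, Finset.mul_sum, ← Finset.sum_add_distrib,
              ← Finset.sum_add_distrib]
            exact Finset.sum_congr rfl fun i _ => by ring
          exact expand _ _
      _ ≤ _ := by
          rw [hw, h1]
          push_cast
          -- The slack is exactly (a - m)²: the second moment about any `a` exceeds the variance by
          -- this much. The freedom in `a` later removes the centering by `Q`.
          nlinarith [sq_nonneg (a - m)]

/-- A Chernoff bound for a sum of bounded independent variables. -/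
theorem iidSum_abs_sub_ge_le (hw0 : ∀ i, 0 ≤ w i) (hw : ∑ i, w i = 1) (f : ι → ℝ) {c t : ℝ}
    (hc : ∑ i, w i * f i = c) (hf : ∀ i, |f i - c| ≤ 1) (ht0 : 0 ≤ t) (ht : t ≤ 2) (n : ℕ) :
    iidSum w f n (fun v => if n * t ≤ |v - n * c| then 1 else 0)
      ≤ 2 * Real.exp (-(n * t ^ 2 / 4)) := by
  -- From exp z ≤ 1 + z + z² for |z| ≤ 1; the linear term has mean zero.
  have mgf : ∀ l : ℝ, |l| ≤ 1 → ∑ i, w i * Real.exp (l * (f i - c)) ≤ Real.exp (l ^ 2) := by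
    intro l hl
    have hb : ∀ i, Real.exp (l * (f i - c)) ≤ 1 + l * (f i - c) + l ^ 2 := by
      intro i
      have h1 : |l * (f i - c)| ≤ 1 := by
        rw [abs_mul]; exact mul_le_one₀ hl (abs_nonneg _) (hf i)
      have h2 := (abs_le.1 (Real.abs_exp_sub_one_sub_id_le h1)).2
      have h3 : (f i - c) ^ 2 ≤ 1 := by
        rw [← sq_abs]; exact pow_le_one₀ (abs_nonneg _) (hf i)
      nlinarith [sq_nonneg l]
    calc ∑ i, w i * Real.exp (l * (f i - c))
        ≤ ∑ i, w i * (1 + l * (f i - c) + l ^ 2) :=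
          Finset.sum_le_sum fun i _ => mul_le_mul_of_nonneg_left (hb i) (hw0 i)
      _ = (1 - l * c + l ^ 2) * ∑ i, w i + l * ∑ i, w i * f i := by
          rw [Finset.mul_sum, Finset.mul_sum, ← Finset.sum_add_distrib]
          exact Finset.sum_congr rfl fun i _ => by ring
      _ = l ^ 2 + 1 := by rw [hw, hc]; ring
      _ ≤ _ := Real.add_one_le_exp _
  have mgf' : ∀ l : ℝ, |l| ≤ 1 →
      iidSum w f n (fun v => Real.exp (l * v)) ≤ Real.exp (n * l ^ 2 + n * (l * c)) := by
    intro l hl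
    rw [iidSum_exp]
    have : ∑ i, w i * Real.exp (l * f i) ≤ Real.exp (l ^ 2 + l * c) := by
      rw [Real.exp_add]
      refine le_trans (le_of_eq ?_) (mul_le_mul_of_nonneg_right (mgf l hl) (Real.exp_pos _).le)
      rw [Finset.sum_mul]
      refine Finset.sum_congr rfl fun i _ => ?_
      rw [mul_assoc, ← Real.exp_add]; ring_nf
    calc _ ≤ Real.exp (l ^ 2 + l * c) ^ n :=
          pow_le_pow_left₀ (Finset.sum_nonneg fun i _ => mul_nonneg (hw0 i) (Real.exp_pos _).le)
            this n
      _ = _ := by rw [← Real.exp_nat_mul]; ring_nf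
  -- Exponential Markov bound for both tails with l = ±t/2, which minimizes n l² - n |l| t.
  have pt : ∀ v : ℝ, (if n * t ≤ |v - n * c| then (1 : ℝ) else 0)
      ≤ Real.exp (-(n * t ^ 2 / 2) - n * (t / 2 * c)) * Real.exp (t / 2 * v)
        + Real.exp (-(n * t ^ 2 / 2) + n * (t / 2 * c)) * Real.exp (-(t / 2) * v) := by
    intro v
    rw [← Real.exp_add, ← Real.exp_add]
    split_ifs with h
    · rcases le_abs.1 h with h | h
      · have : (1 : ℝ) ≤ Real.exp (-(n * t ^ 2 / 2) - n * (t / 2 * c) + t / 2 * v) := by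
          rw [← Real.exp_zero]; exact Real.exp_le_exp.2 (by nlinarith)
        linarith [Real.exp_pos (-(n * t ^ 2 / 2) + n * (t / 2 * c) + -(t / 2) * v)]
      · have : (1 : ℝ) ≤ Real.exp (-(n * t ^ 2 / 2) + n * (t / 2 * c) + -(t / 2) * v) := by
          rw [← Real.exp_zero]; exact Real.exp_le_exp.2 (by nlinarith)
        linarith [Real.exp_pos (-(n * t ^ 2 / 2) - n * (t / 2 * c) + t / 2 * v)]
    · positivity
  have hl1 : |t / 2| ≤ 1 := by rw [abs_of_nonneg (by linarith)]; linarith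
  have hl2 : |-(t / 2)| ≤ 1 := by rw [abs_neg]; exact hl1
  refine (iidSum_mono hw0 f n pt).trans ?_
  rw [iidSum_add, iidSum_const_mul, iidSum_const_mul]
  refine (add_le_add (mul_le_mul_of_nonneg_left (mgf' _ hl1) (Real.exp_pos _).le)
    (mul_le_mul_of_nonneg_left (mgf' _ hl2) (Real.exp_pos _).le)).trans (le_of_eq ?_)
  rw [← Real.exp_add, ← Real.exp_add, two_mul]
  congr 2 <;> ring

end iidSum

/-! ### Repeating an oracle call. -/

namespace PaircondAlg

variable {N : ℕ} {V : Type*} [AddCommMonoid V]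

/-- Draw `n` samples, add up the values of `f` at them, and continue according to the sum. -/
def sampSum (f : Fin N → V) : ℕ → (V → PaircondAlg N) → PaircondAlg N
  | 0, k => k 0
  | n + 1, k => samp fun x => sampSum f n fun v => k (f x + v)

theorem outProb_sampSum (D : Fin N → ℝ) (f : Fin N → V) (n : ℕ) (k : V → PaircondAlg N)
    (b : Bool) :
    (sampSum f n k).outProb D b = iidSum D f n fun v => (k v).outProb D b := by
  induction n generalizing k with
  | zero => rfl
  | succ n ih => simp only [sampSum, outProb, iidSum, ih]

theorem queries_sampSum_le (f : Fin N → V) (n : ℕ) {k : V → PaircondAlg N} {q : ℕ}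
    (hk : ∀ v, (k v).queries ≤ q) : (sampSum f n k).queries ≤ n + q := by
  induction n generalizing k with
  | zero => simpa [sampSum] using hk 0
  | succ n ih =>
    simp only [sampSum, queries]
    have : (Finset.univ.sup fun i => (sampSum f n fun v => k (f i + v)).queries) ≤ n + q :=
      Finset.sup_le fun i _ => ih fun v => hk _
    omega

theorem IsProper.sampSum {D : Fin N → ℝ} (hD : D ∈ stdSimplex ℝ (Fin N)) (f : Fin N → V) (n : ℕ)
    {k : V → PaircondAlg N} (hk : ∀ v, IsProper D (k v)) : IsProper D (sampSum f n k) := by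
  induction n generalizing k with
  | zero => exact hk 0
  | succ n ih => exact IsProper.samp hD fun i _ => ih fun v => hk _

/-- Query PCOND `n` times on `x`, `y`, add `f true` for each answer `x` and `f false` for each
answer `y`, and continue according to the sum. -/
def pcondSum (x y : Fin N) (hxy : x ≠ y) (f : Bool → V) :
    ℕ → (V → PaircondAlg N) → PaircondAlg N
  | 0, k => k 0
  | n + 1, k => pcond x y hxy (pcondSum x y hxy f n fun v => k (f true + v))
      (pcondSum x y hxy f n fun v => k (f false + v))

/-- The law of the answer of PCOND on `x`, `y`, with `true` standing for `x`. -/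
noncomputable def pcondLaw (D : Fin N → ℝ) (x y : Fin N) : Bool → ℝ
  | true => D x / (D x + D y)
  | false => D y / (D x + D y)

theorem outProb_pcondSum (D : Fin N → ℝ) {x y : Fin N} (hxy : x ≠ y) (f : Bool → V) (n : ℕ)
    (k : V → PaircondAlg N) (b : Bool) :
    (pcondSum x y hxy f n k).outProb D b
      = iidSum (pcondLaw D x y) f n fun v => (k v).outProb D b := by
  induction n generalizing k with
  | zero => rfl
  | succ n ih => simp only [pcondSum, outProb, iidSum, ih, Fintype.sum_bool, pcondLaw]

theorem queries_pcondSum_le {x y : Fin N} (hxy : x ≠ y) (f : Bool → V) (n : ℕ)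
    {k : V → PaircondAlg N} {q : ℕ} (hk : ∀ v, (k v).queries ≤ q) :
    (pcondSum x y hxy f n k).queries ≤ n + q := by
  induction n generalizing k with
  | zero => simpa [pcondSum] using hk 0
  | succ n ih =>
    simp only [pcondSum, queries]
    have h1 := ih (k := fun v => k (f true + v)) fun v => hk _
    have h2 := ih (k := fun v => k (f false + v)) fun v => hk _
    omega

theorem IsProper.pcondSum {D : Fin N → ℝ} {x y : Fin N} (hxy : x ≠ y) (hD : D x + D y ≠ 0)
    (f : Bool → V) (n : ℕ) {k : V → PaircondAlg N} (hk : ∀ v, IsProper D (k v)) :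
    IsProper D (pcondSum x y hxy f n k) := by
  induction n generalizing k with
  | zero => exact hk 0
  | succ n ih => exact IsProper.pcond hxy hD (ih fun v => hk _) (ih fun v => hk _)

end PaircondAlg

/-! ### The bilinear statistic of the coarse test and its second moment. -/

section WeightedInner

variable {ι : Type*} [Fintype ι]

/-- The weighted inner product `∑ i, A i * B i / w i`, as a function of `B`. -/
noncomputable def weightedInner (w A : ι → ℝ) : (ι → ℝ) →+ ℝ :=
  AddMonoidHom.mk' (fun B => ∑ i, A i * B i / w i) fun B C => by
    simp only [Pi.add_apply, mul_add, add_div, Finset.sum_add_distrib]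

theorem weightedInner_apply (w A B : ι → ℝ) : weightedInner w A B = ∑ i, A i * B i / w i := rfl

theorem weightedInner_comm (w A B : ι → ℝ) : weightedInner w A B = weightedInner w B A := by
  simp only [weightedInner_apply, mul_comm]

variable {α : Type*} [DecidableEq ι]

/-- The indicator vector of the cell of `x`, centered at `Q`. -/
def centeredCell (b : α → ι) (Q : ι → ℝ) (x : α) : ι → ℝ :=
  Pi.single (b x) 1 - Q

theorem weightedInner_centeredCell (b : α → ι) (Q w A : ι → ℝ) (x : α) :
    weightedInner w A (centeredCell b Q x) = A (b x) / w (b x) - weightedInner w A Q := by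
  rw [centeredCell, map_sub]
  congr 1
  simp [weightedInner_apply, Pi.single_apply, ite_div]

end WeightedInner

section Pushforward

variable {α ι : Type*} [Fintype α] [DecidableEq ι]

/-- The distribution of `b X` when `X` has weights `D`. -/
def pushWeight (b : α → ι) (D : α → ℝ) (i : ι) : ℝ :=
  ∑ x with b x = i, D x

theorem pushWeight_nonneg {D : α → ℝ} (hD : ∀ x, 0 ≤ D x) (b : α → ι) (i : ι) :
    0 ≤ pushWeight b D i :=
  Finset.sum_nonneg fun x _ => hD x

variable [Fintype ι]

theorem sum_mul_comp_eq (b : α → ι) (D : α → ℝ) (g : ι → ℝ) :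
    ∑ x, D x * g (b x) = ∑ i, pushWeight b D i * g i := by
  rw [← Finset.sum_fiberwise (s := Finset.univ) (g := b)]
  refine Finset.sum_congr rfl fun i _ => ?_
  rw [pushWeight, Finset.sum_mul]
  refine Finset.sum_congr rfl fun x hx => ?_
  rw [(Finset.mem_filter.1 hx).2]

theorem sum_pushWeight (b : α → ι) (D : α → ℝ) : ∑ i, pushWeight b D i = ∑ x, D x := by
  simpa using (sum_mul_comp_eq b D fun _ => 1).symm

variable {D : α → ℝ}

/-- For fixed `A` the statistic is a sum of independent reals, each equal to `A i / w i` at the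
sampled cell minus a constant. Taking second moments about minus that constant leaves only the first
term. -/
theorem iidSum_weightedInner_sub_sq_le (hD0 : ∀ x, 0 ≤ D x) (hD : ∑ x, D x = 1) (b : α → ι)
    (Q w A : ι → ℝ) (n : ℕ) (c : ℝ) :
    iidSum D (centeredCell b Q) n (fun B => (weightedInner w A B - c) ^ 2)
      ≤ n * ∑ i, pushWeight b D i * (A i / w i) ^ 2
        + (n * weightedInner w A (pushWeight b D - Q) - c) ^ 2 := by
  rw [iidSum_comp D (centeredCell b Q) (weightedInner w A) n fun v => (v - c) ^ 2]
  refine (iidSum_sub_sq_le hD0 hD _ n (-weightedInner w A Q) c).trans (le_of_eq ?_)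
  simp only [weightedInner_centeredCell, sub_neg_eq_add, sub_add_cancel]
  rw [sum_mul_comp_eq b D fun i => (A i / w i) ^ 2]
  congr 4
  simp only [mul_sub, Finset.sum_sub_distrib, ← Finset.sum_mul, hD, one_mul, map_sub]
  rw [sum_mul_comp_eq b D fun i => A i / w i, weightedInner_apply w A (pushWeight b D)]
  congr 1
  exact Finset.sum_congr rfl fun i _ => by ring

theorem iidSum_apply_sq_le (hD0 : ∀ x, 0 ≤ D x) (hD : ∑ x, D x = 1) (b : α → ι)
    (Q : ι → ℝ) (n : ℕ) (i : ι) :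
    iidSum D (centeredCell b Q) n (fun A => A i ^ 2)
      ≤ n * pushWeight b D i + n ^ 2 * (pushWeight b D i - Q i) ^ 2 := by
  have h := iidSum_weightedInner_sub_sq_le hD0 hD b Q (fun _ => 1) (Pi.single i 1) n 0
  simpa [weightedInner_apply, Pi.single_apply, mul_pow] using h

/-- The second moment of the bilinear statistic around its mean. -/
theorem iidSum_iidSum_weightedInner_sub_sq_le (hD0 : ∀ x, 0 ≤ D x) (hD : ∑ x, D x = 1)
    (b : α → ι) (Q w : ι → ℝ) (n : ℕ) {δ : ι → ℝ} (hδ : δ = pushWeight b D - Q) :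
    iidSum D (centeredCell b Q) n (fun A => iidSum D (centeredCell b Q) n fun B =>
        (weightedInner w A B - n ^ 2 * weightedInner w δ δ) ^ 2)
      ≤ n ^ 2 * ∑ i, (pushWeight b D i / w i) ^ 2
        + 2 * n ^ 3 * ∑ i, pushWeight b D i * (δ i / w i) ^ 2 := by
  set f := centeredCell b Q
  set P := pushWeight b D
  set μ := weightedInner w δ δ
  -- Conditionally on the first batch `A`: a variance term, diagonal in `A`, plus the squared bias,
  -- which is linear in `A` before squaring.
  have h1 : ∀ A : ι → ℝ, iidSum D f n (fun B => (weightedInner w A B - n ^ 2 * μ) ^ 2)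
      ≤ ∑ i, (n * P i / w i ^ 2) * A i ^ 2 + n ^ 2 * (weightedInner w δ A - n * μ) ^ 2 := by
    intro A
    refine (iidSum_weightedInner_sub_sq_le hD0 hD b Q w A n _).trans (le_of_eq ?_)
    rw [← hδ, weightedInner_comm w A δ, Finset.mul_sum]
    congr 1
    · exact Finset.sum_congr rfl fun i _ => by rw [div_pow]; ring
    · ring
  -- Here `n * μ` is the exact mean, so the bias of this second application vanishes.
  have h2 := iidSum_weightedInner_sub_sq_le hD0 hD b Q w δ n (n * μ)
  rw [← hδ, sub_self, zero_pow two_ne_zero, add_zero] at h2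
  refine (iidSum_mono hD0 f n h1).trans ?_
  rw [iidSum_add, iidSum_sum, iidSum_const_mul]
  have h3 : ∀ i, iidSum D f n (fun A => (n * P i / w i ^ 2) * A i ^ 2)
      ≤ n ^ 2 * (P i / w i) ^ 2 + n ^ 3 * (P i * (δ i / w i) ^ 2) := by
    intro i
    rw [iidSum_const_mul]
    have hP : 0 ≤ P i := pushWeight_nonneg hD0 b i
    refine (mul_le_mul_of_nonneg_left (iidSum_apply_sq_le hD0 hD b Q n i)
      (by positivity)).trans (le_of_eq ?_)
    rw [hδ, Pi.sub_apply, div_pow, div_pow]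
    ring
  refine (add_le_add (Finset.sum_le_sum fun i _ => h3 i)
    (mul_le_mul_of_nonneg_left h2 (by positivity))).trans (le_of_eq ?_)
  rw [Finset.sum_add_distrib, Finset.mul_sum, Finset.mul_sum, Finset.mul_sum, Finset.mul_sum,
    add_assoc, ← Finset.sum_add_distrib, ← Finset.sum_add_distrib, ← Finset.sum_add_distrib]
  exact Finset.sum_congr rfl fun i _ => by ring

end Pushforward

/-! ### Bounding the second moment by the weighted squared distance. -/

section Weights

variable {ι : Type*} [Fintype ι] {P Q w : ι → ℝ} {k : ℝ}

/-- Cauchy–Schwarz. The total weight 2 is that of `Q` plus the uniform distribution. -/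
theorem sq_sum_abs_le_weightedInner (hw : ∀ i, 0 < w i) (hw2 : ∑ i, w i = 2) (δ : ι → ℝ) :
    (∑ i, |δ i|) ^ 2 ≤ 2 * weightedInner w δ δ := by
  have h := Finset.sum_sq_le_sum_mul_sum_of_sq_le_mul Finset.univ (r := fun i => |δ i|)
    (f := w) (g := fun i => δ i * δ i / w i) (fun i _ => (hw i).le)
    (fun i _ => div_nonneg (mul_self_nonneg _) (hw i).le)
    (fun i _ => by rw [sq_abs, mul_div_cancel₀ _ (hw i).ne', sq])
  rwa [hw2] at h

/-- With δ = P - Q one has P² ≤ (w + δ)² ≤ 2w² + 2δ², and the floor w ≥ 1/k turns δ²/w² into at most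
k δ²/w. -/
theorem sum_div_sq_le (hw : ∀ i, 0 < w i) (hP : ∀ i, 0 ≤ P i) (hQ : ∀ i, Q i ≤ w i)
    (hk : ∀ i, 1 ≤ k * w i) :
    ∑ i, (P i / w i) ^ 2 ≤ 2 * Fintype.card ι + 2 * k * weightedInner w (P - Q) (P - Q) := by
  have : ∀ i, (P i / w i) ^ 2 ≤ 2 + 2 * k * ((P - Q) i * (P - Q) i / w i) := by
    intro i
    have hwi := hw i
    rw [div_pow, div_le_iff₀ (by positivity), Pi.sub_apply]
    have e : (2 + 2 * k * ((P i - Q i) * (P i - Q i) / w i)) * w i ^ 2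
        = 2 * w i ^ 2 + 2 * ((k * w i) * (P i - Q i) ^ 2) := by field_simp
    rw [e]
    have h1 : (P i - Q i) ^ 2 ≤ k * w i * (P i - Q i) ^ 2 :=
      le_mul_of_one_le_left (sq_nonneg _) (hk i)
    have h2 : P i ^ 2 ≤ (w i + (P i - Q i)) ^ 2 :=
      pow_le_pow_left₀ (hP i) (by linarith [hQ i]) 2
    nlinarith [sq_nonneg (w i - (P i - Q i))]
  refine (Finset.sum_le_sum fun i _ => this i).trans (le_of_eq ?_)
  rw [Finset.sum_add_distrib, ← Finset.mul_sum, ← weightedInner_apply]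
  simp [mul_comm]

/-- Pointwise P/w ≤ 1 + δ/w, and (δ/w)² ≤ k δ²/w is at most k times the whole sum. -/
theorem sum_mul_div_sq_le (hw : ∀ i, 0 < w i) (hQ : ∀ i, Q i ≤ w i) (hk : ∀ i, 1 ≤ k * w i) :
    ∑ i, P i * ((P - Q) i / w i) ^ 2
      ≤ (1 + √(k * weightedInner w (P - Q) (P - Q))) * weightedInner w (P - Q) (P - Q) := by
  set δ := P - Q with hδ
  set μ := weightedInner w δ δ with hμ
  have hterm : ∀ i, 0 ≤ δ i * δ i / w i := fun i => div_nonneg (mul_self_nonneg _) (hw i).le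
  have hsum : (1 + √(k * μ)) * μ = ∑ i, (1 + √(k * μ)) * (δ i * δ i / w i) := by
    rw [← Finset.mul_sum]; rfl
  rw [hsum]
  refine Finset.sum_le_sum fun i _ => ?_
  have hwi := hw i
  have hk0 : 0 ≤ k := by
    by_contra h
    nlinarith [hk i]
  have hle : δ i * δ i / w i ≤ μ :=
    Finset.single_le_sum (f := fun i => δ i * δ i / w i) (fun j _ => hterm j) (Finset.mem_univ i)
  have h1 : δ i / w i ≤ √(k * μ) := by
    apply Real.le_sqrt_of_sq_le
    calc (δ i / w i) ^ 2 ≤ k * w i * (δ i / w i) ^ 2 :=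
          le_mul_of_one_le_left (sq_nonneg _) (hk i)
      _ = k * (δ i * δ i / w i) := by field_simp
      _ ≤ k * μ := mul_le_mul_of_nonneg_left hle hk0
  have h2 : P i / w i ≤ 1 + √(k * μ) := by
    have : P i / w i = Q i / w i + δ i / w i := by
      rw [← add_div, hδ, Pi.sub_apply, add_sub_cancel]
    have h3 : Q i / w i ≤ 1 := (div_le_one hwi).2 (hQ i)
    linarith
  calc P i * (δ i / w i) ^ 2 = P i / w i * (δ i * δ i / w i) := by field_simp
    _ ≤ _ := mul_le_mul_of_nonneg_right h2 (hterm i)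

end Weights

/-- The numerical heart of the analysis of the coarse test in the far case. -/
theorem variance_bound_le {n k μ₀ μ : ℝ} (hk : 1 ≤ k) (hμ₀ : 0 < μ₀) (hμ₁ : μ₀ ≤ 1) (hμ : μ₀ ≤ μ)
    (hn : 64 * √k ≤ n * μ₀) :
    n ^ 2 * (2 * k + 2 * k * μ) + 2 * n ^ 3 * ((1 + √(k * μ)) * μ) ≤ (n ^ 2 * μ) ^ 2 / 12 := by
  have hs : 1 ≤ √k := Real.one_le_sqrt.2 hk
  have hμpos : 0 < μ := hμ₀.trans_le hμ
  have hn0 : 0 < n := by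
    by_contra h
    nlinarith
  have hk2 : √k ^ 2 = k := Real.sq_sqrt (by linarith)
  rw [Real.sqrt_mul (by linarith)]
  set s := √k
  set m := √μ with hm
  have hm0 : 0 < m := Real.sqrt_pos.2 hμpos
  have hm2 : m ^ 2 = μ := Real.sq_sqrt hμpos.le
  -- Since μ₀ ≤ 1, both μ and √μ dominate μ₀, so the hypothesis on `n` bounds n μ and n √μ from
  -- below by 64 √k.
  have hmμ : μ₀ ≤ m := by
    apply Real.le_sqrt_of_sq_le
    nlinarith
  have a1 : 64 * s ≤ n * μ := hn.trans (by gcongr)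
  have a2 : 64 * s ≤ n * m := hn.trans (by gcongr)
  rw [← hk2]
  have e1 : (64 * s) ^ 2 ≤ (n * μ) ^ 2 := by gcongr
  have e2 : (64 * s) ^ 2 ≤ n ^ 2 * μ := by
    rw [← hm2, ← mul_pow]; gcongr
  have e3 : 64 ≤ n * μ := by linarith
  have t1 : n ^ 2 * (2 * s ^ 2) ≤ n ^ 2 * ((n * μ) ^ 2 / 2048) := by
    gcongr; linarith
  have t2 : n ^ 2 * (2 * s ^ 2 * μ) ≤ n ^ 2 * (n ^ 2 * μ / 2048 * μ) := by
    gcongr; linarith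
  have t3 : 2 * n ^ 3 * μ * 64 ≤ 2 * n ^ 3 * μ * (n * μ) := by gcongr
  have t4 : 2 * n ^ 3 * (m * μ) * (64 * s) ≤ 2 * n ^ 3 * (m * μ) * (n * m) := by gcongr
  have t4' : 2 * n ^ 3 * (m * μ) * (n * m) = 2 * n ^ 4 * μ ^ 2 := by
    rw [← hm2]; ring
  have hp : 0 ≤ n ^ 4 * μ ^ 2 := by positivity
  nlinarith

/-! ### The coarse test: masses of the cells. -/

namespace PaircondAlg

variable {N : ℕ} {ι : Type*} [Fintype ι] [DecidableEq ι]

open Classical in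
/-- Compare the distribution of the cell `b X` of a sample `X` with `Q`: take two independent
batches of `n` samples, and accept if the inner product of the two vectors of centered counts
is at most `T`. -/
noncomputable def cellTest (b : Fin N → ι) (Q w : ι → ℝ) (n : ℕ) (T : ℝ) : PaircondAlg N :=
  sampSum (centeredCell b Q) n fun A => sampSum (centeredCell b Q) n fun B =>
    output (decide (weightedInner w A B ≤ T))

theorem queries_cellTest_le (b : Fin N → ι) (Q w : ι → ℝ) (n : ℕ) (T : ℝ) :
    (cellTest b Q w n T).queries ≤ 2 * n := by
  rw [two_mul]
  exact queries_sampSum_le _ n fun A => queries_sampSum_le _ n (q := 0) fun B => le_rfl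

theorem isProper_cellTest {D : Fin N → ℝ} (hD : D ∈ stdSimplex ℝ (Fin N)) (b : Fin N → ι)
    (Q w : ι → ℝ) (n : ℕ) (T : ℝ) : IsProper D (cellTest b Q w n T) :=
  IsProper.sampSum hD _ _ fun _ => IsProper.sampSum hD _ _ fun _ => IsProper.output D _

/-- Chebyshev's inequality for the answers of `cellTest`. -/
theorem outProb_cellTest_le {D : Fin N → ℝ} (hD : D ∈ stdSimplex ℝ (Fin N)) (b : Fin N → ι)
    (Q w : ι → ℝ) (n : ℕ) (T : ℝ) (a : Bool) {t : ℝ} (ht : 0 < t)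
    (h : ∀ z : ℝ, (decide (z ≤ T)) = a →
      t ^ 2 ≤ (z - n ^ 2 * weightedInner w (pushWeight b D - Q) (pushWeight b D - Q)) ^ 2) :
    (cellTest b Q w n T).outProb D a
      ≤ (t ^ 2)⁻¹ * (n ^ 2 * ∑ i, (pushWeight b D i / w i) ^ 2
        + 2 * n ^ 3 * ∑ i, pushWeight b D i * ((pushWeight b D - Q) i / w i) ^ 2) := by
  refine le_trans ?_ (mul_le_mul_of_nonneg_left
    (iidSum_iidSum_weightedInner_sub_sq_le hD.1 hD.2 b Q w n rfl) (by positivity))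
  rw [cellTest, outProb_sampSum, ← iidSum_const_mul]
  refine iidSum_mono hD.1 _ _ fun A => ?_
  rw [outProb_sampSum, ← iidSum_const_mul]
  refine iidSum_mono hD.1 _ _ fun B => ?_
  simp only [outProb]
  split_ifs with hz
  · rw [inv_mul_eq_div, one_le_div (by positivity)]
    exact h _ (by simpa using hz)
  · positivity

theorem exists_cellTest [Nonempty ι] (b : Fin N → ι) {Q : ι → ℝ} (hQ : Q ∈ stdSimplex ℝ ι) {ε : ℝ}
    (hε : 0 < ε) (hε1 : ε ≤ 1) {n : ℕ} (hn : 512 * √(Fintype.card ι) ≤ n * ε ^ 2) :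
    ∃ A : PaircondAlg N, A.queries ≤ 2 * n ∧ ∀ D ∈ stdSimplex ℝ (Fin N), IsProper D A ∧
      (pushWeight b D = Q → 9 / 10 ≤ A.outProb D true) ∧
      (ε / 2 ≤ ∑ i, |pushWeight b D i - Q i| → A.outProb D true ≤ 1 / 3) := by
  set k : ℝ := (Fintype.card ι : ℝ) with hk
  have hk1 : 1 ≤ k := by
    rw [hk]; exact_mod_cast Fintype.card_pos
  have hk0 : 0 < k := by linarith
  -- Mixing in the uniform distribution keeps the weights away from zero while the total stays 2.
  set w : ι → ℝ := fun i => Q i + k⁻¹ with hw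
  have hwpos : ∀ i, 0 < w i := fun i => add_pos_of_nonneg_of_pos (hQ.1 i) (inv_pos.2 hk0)
  have hQw : ∀ i, Q i ≤ w i := fun i => le_add_of_nonneg_right (inv_pos.2 hk0).le
  have hkw : ∀ i, 1 ≤ k * w i := fun i => by
    rw [hw]
    simp only [mul_add, mul_inv_cancel₀ hk0.ne']
    linarith [mul_nonneg hk0.le (hQ.1 i)]
  have hw2 : ∑ i, w i = 2 := by
    rw [hw, Finset.sum_add_distrib, hQ.2, Finset.sum_const, Finset.card_univ, nsmul_eq_mul,
      ← hk, mul_inv_cancel₀ hk0.ne']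
    norm_num
  -- The least weighted squared distance in the far case: (ε/2)² ≤ 2μ. The acceptance threshold is
  -- half of the corresponding mean `n ^ 2 * μ₀`.
  set μ₀ : ℝ := ε ^ 2 / 8 with hμ₀
  have hμ₀pos : 0 < μ₀ := by positivity
  have hμ₀1 : μ₀ ≤ 1 := by rw [hμ₀]; nlinarith
  have hn' : 64 * √k ≤ n * μ₀ := by rw [hμ₀]; linarith
  have hs : 1 ≤ √k := Real.one_le_sqrt.2 hk1
  have hn0 : 0 < (n : ℝ) := by
    by_contra h
    nlinarith
  refine ⟨cellTest b Q w n (n ^ 2 * μ₀ / 2), queries_cellTest_le _ _ _ _ _, fun D hD =>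
    ⟨isProper_cellTest hD _ _ _ _ _, fun hPQ => ?_, fun hfar => ?_⟩⟩
  · have hprop := isProper_cellTest hD b Q w n (n ^ 2 * μ₀ / 2)
    have h := outProb_cellTest_le hD b Q w n (n ^ 2 * μ₀ / 2) false
      (t := n ^ 2 * μ₀ / 2) (by positivity) fun z hz => by
        simp only [hPQ, sub_self, map_zero, mul_zero, sub_zero]
        have : n ^ 2 * μ₀ / 2 < z := by simpa using hz
        gcongr
    have hsum := sum_div_sq_le (P := Q) hwpos hQ.1 hQw hkw
    simp only [hPQ, sub_self, Pi.zero_apply, zero_div, zero_pow two_ne_zero, mul_zero,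
      Finset.sum_const_zero, add_zero, map_zero] at h hsum
    have hfalse : (cellTest b Q w n (n ^ 2 * μ₀ / 2)).outProb D false ≤ 1 / 10 := by
      refine h.trans ?_
      rw [inv_mul_eq_div, div_le_iff₀ (by positivity)]
      have h1 : (64 * √k) ^ 2 ≤ (n * μ₀) ^ 2 := by gcongr
      rw [mul_pow, Real.sq_sqrt hk0.le] at h1
      calc (n : ℝ) ^ 2 * ∑ i, (Q i / w i) ^ 2 ≤ n ^ 2 * (2 * k) := by gcongr
        _ ≤ n ^ 2 * ((n * μ₀) ^ 2 / 40) := by gcongr; linarith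
        _ = _ := by ring
    unfold IsProper at hprop
    linarith
  · set μ := weightedInner w (pushWeight b D - Q) (pushWeight b D - Q) with hμ
    have hμμ : μ₀ ≤ μ := by
      have h1 := sq_sum_abs_le_weightedInner hwpos hw2 (pushWeight b D - Q)
      have h2 : (ε / 2) ^ 2 ≤ (∑ i, |(pushWeight b D - Q) i|) ^ 2 := by
        simp only [Pi.sub_apply]; gcongr
      rw [← hμ] at h1
      rw [hμ₀]; linarith
    have hμpos : 0 < μ := hμ₀pos.trans_le hμμ
    have h := outProb_cellTest_le hD b Q w n (n ^ 2 * μ₀ / 2) true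
      (t := n ^ 2 * μ / 2) (by positivity) fun z hz => by
        rw [← hμ, ← neg_sq (z - _), neg_sub]
        have h1 : z ≤ n ^ 2 * μ₀ / 2 := by simpa using hz
        have h2 : (n : ℝ) ^ 2 * μ₀ ≤ n ^ 2 * μ := by gcongr
        have h3 : n ^ 2 * μ / 2 ≤ n ^ 2 * μ - z := by linarith
        gcongr
    refine h.trans ?_
    rw [inv_mul_eq_div, div_le_iff₀ (by positivity)]
    have s1 := sum_div_sq_le hwpos (pushWeight_nonneg hD.1 b) hQw hkw
    have s2 := sum_mul_div_sq_le (P := pushWeight b D) hwpos hQw hkw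
    rw [← hμ, ← hk] at s1
    rw [← hμ] at s2
    calc _ ≤ (n : ℝ) ^ 2 * (2 * k + 2 * k * μ) + 2 * n ^ 3 * ((1 + √(k * μ)) * μ) := by gcongr
      _ ≤ (n ^ 2 * μ) ^ 2 / 12 := variance_bound_le hk1 hμ₀pos hμ₀1 hμμ hn'
      _ = _ := by ring

end PaircondAlg

/-! ### The fine test: comparing pairs inside a cell. -/

namespace PaircondAlg

variable {N : ℕ}

/-- Draw a uniform element of `s` (accept if `s` is empty). -/
def randMem (s : Finset (Fin N)) (k : Fin N → PaircondAlg N) : PaircondAlg N :=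
  if h : 0 < s.card then
    rand (s.card - 1) fun i => k (s.orderEmbOfFin (Nat.sub_add_cancel h).symm i)
  else output true

theorem outProb_randMem (D : Fin N → ℝ) {s : Finset (Fin N)} (hs : s.Nonempty)
    (k : Fin N → PaircondAlg N) (b : Bool) :
    (randMem s k).outProb D b = (∑ y ∈ s, (k y).outProb D b) / s.card := by
  have h := hs.card_pos
  have hc := Nat.sub_add_cancel h
  rw [randMem, dif_pos h]
  simp only [outProb]
  congr 1
  · conv_rhs => rw [← Finset.image_orderEmbOfFin_univ s hc.symm]
    rw [Finset.sum_image fun x _ y _ hxy => (s.orderEmbOfFin hc.symm).injective hxy]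
  · exact_mod_cast hc

theorem queries_randMem_le (s : Finset (Fin N)) {k : Fin N → PaircondAlg N} {q : ℕ}
    (hk : ∀ y, (k y).queries ≤ q) : (randMem s k).queries ≤ q := by
  unfold randMem
  split_ifs
  · exact Finset.sup_le fun i _ => hk _
  · exact Nat.zero_le _

theorem IsProper.randMem {D : Fin N → ℝ} (s : Finset (Fin N)) {k : Fin N → PaircondAlg N}
    (hk : ∀ y ∈ s, IsProper D (k y)) : IsProper D (randMem s k) := by
  unfold PaircondAlg.randMem
  split_ifs with h
  · exact IsProper.rand fun i => hk _ (Finset.orderEmbOfFin_mem s _ i)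
  · exact IsProper.output D true

theorem pcondLaw_nonneg {D : Fin N → ℝ} (hD : ∀ i, 0 ≤ D i) (x y : Fin N) (a : Bool) :
    0 ≤ pcondLaw D x y a := by
  cases a <;> exact div_nonneg (hD _) (add_nonneg (hD _) (hD _))

theorem sum_pcondLaw {D : Fin N → ℝ} {x y : Fin N} (h : D x + D y ≠ 0) :
    ∑ a, pcondLaw D x y a = 1 := by
  rw [Fintype.sum_bool, pcondLaw, pcondLaw, ← add_div, div_self h]

/-- How much the law of PCOND on `x`, `y` differs between `D` and `D'`. -/
noncomputable def pcondDev (D D' : Fin N → ℝ) (x y : Fin N) : ℝ :=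
  |pcondLaw D x y true - pcondLaw D' x y true|

open Classical in
/-- Decide from `m` PCOND queries on `x`, `y` whether their law is the one of `D'`. -/
noncomputable def ratioTest (D' : Fin N → ℝ) (m : ℕ) (t : ℝ) (x y : Fin N) : PaircondAlg N :=
  if hxy : x ≠ y then
    pcondSum x y hxy (fun a => (if a then 1 else 0) - pcondLaw D' x y true) m fun v =>
      output (decide (|v| ≤ m * t))
  else output true

section RatioTest

variable {D D' : Fin N → ℝ} {x y : Fin N}

theorem queries_ratioTest_le (D' : Fin N → ℝ) (m : ℕ) (t : ℝ) (x y : Fin N) :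
    (ratioTest D' m t x y).queries ≤ m := by
  unfold ratioTest
  split_ifs with h
  · exact queries_pcondSum_le h _ m (q := 0) fun v => le_rfl
  · exact Nat.zero_le _

theorem isProper_ratioTest (hD : ∀ i, 0 ≤ D i) (hx : 0 < D x) (m : ℕ) (t : ℝ) :
    IsProper D (ratioTest D' m t x y) := by
  unfold ratioTest
  split_ifs with h
  · exact IsProper.pcondSum h (by linarith [hD y]) _ m fun v => IsProper.output D _
  · exact IsProper.output D true

/-- Covers both kinds of error: `h` says that the answer `a` forces the sum to be at least `m * t`
away from its mean. -/
theorem outProb_ratioTest_le (hD : ∀ i, 0 ≤ D i) (hx : 0 < D x) (hxy : x ≠ y) (m : ℕ) {t : ℝ}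
    (ht0 : 0 ≤ t) (ht : t ≤ 2) (a : Bool)
    (h : ∀ v : ℝ, decide (|v| ≤ m * t) = a →
      m * t ≤ |v - m * (pcondLaw D x y true - pcondLaw D' x y true)|) :
    (ratioTest D' m t x y).outProb D a ≤ 2 * Real.exp (-(m * t ^ 2 / 4)) := by
  have hxy0 : D x + D y ≠ 0 := by linarith [hD y]
  have hsum := sum_pcondLaw hxy0
  have h1 := pcondLaw_nonneg hD x y true
  have h2 := pcondLaw_nonneg hD x y false
  rw [Fintype.sum_bool] at hsum
  refine le_trans ?_ (iidSum_abs_sub_ge_le (w := pcondLaw D x y) (pcondLaw_nonneg hD x y)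
    (sum_pcondLaw hxy0) (fun a => (if a then 1 else 0) - pcondLaw D' x y true)
    (c := pcondLaw D x y true - pcondLaw D' x y true) ?_ ?_ ht0 ht m)
  · rw [ratioTest, dif_pos hxy, outProb_pcondSum]
    refine iidSum_mono (pcondLaw_nonneg hD x y) _ _ fun v => ?_
    simp only [outProb]
    split_ifs with h3 h4
    · exact le_rfl
    · exact absurd (h v (by simpa using h3)) h4
    · exact zero_le_one
    · exact le_rfl
  · simp only [Fintype.sum_bool, if_true, Bool.false_eq_true, if_false]
    linear_combination -(pcondLaw D' x y true) * hsum
  · intro a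
    rw [abs_le]
    cases a <;> simp <;> constructor <;> linarith

theorem outProb_ratioTest_self_ge (hD : ∀ i, 0 ≤ D i) (hx : 0 < D x) (m : ℕ) {t : ℝ}
    (ht0 : 0 ≤ t) (ht : t ≤ 2) :
    1 - 2 * Real.exp (-(m * t ^ 2 / 4)) ≤ (ratioTest D m t x y).outProb D true := by
  by_cases hxy : x ≠ y
  · have hp := isProper_ratioTest (D' := D) (y := y) hD hx m t
    have h := outProb_ratioTest_le (D' := D) hD hx hxy m ht0 ht false fun v hv => by
      have : m * t < |v| := by simpa using hv
      simpa using this.le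
    unfold IsProper at hp
    linarith
  · rw [ratioTest, dif_neg hxy]
    simp only [outProb, if_true]
    linarith [Real.exp_pos (-(m * t ^ 2 / 4))]

theorem outProb_ratioTest_true_le (hD : ∀ i, 0 ≤ D i) (hx : 0 < D x) (hx' : 0 < D' x) {m : ℕ}
    {t : ℝ} (ht0 : 0 < t) (ht : t ≤ 2) (hm : 2 * Real.exp (-(m * t ^ 2 / 4)) ≤ 1 / 2) :
    (ratioTest D' m t x y).outProb D true
      ≤ 1 - 1 / 2 * (if 2 * t ≤ pcondDev D D' x y then 1 else 0) := by
  split_ifs with h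
  -- A pair x = x has deviation 0, so accepting it without queries misses nothing.
  · have hxy : x ≠ y := by
      rintro rfl
      have : pcondDev D D' x x = 0 := by
        rw [pcondDev, pcondLaw, pcondLaw, ← two_mul, ← two_mul, div_mul_cancel_right₀ hx.ne',
          div_mul_cancel_right₀ hx'.ne', sub_self, abs_zero]
      linarith
    refine (outProb_ratioTest_le hD hx hxy m ht0.le ht true fun v hv => ?_).trans (by linarith)
    have hv' : |v| ≤ m * t := by simpa using hv
    have h1 : m * (2 * t) ≤ |m * (pcondLaw D x y true - pcondLaw D' x y true)| := by
      rw [abs_mul, Nat.abs_cast]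
      exact mul_le_mul_of_nonneg_left h (Nat.cast_nonneg m)
    have h2 := abs_sub_abs_le_abs_sub (m * (pcondLaw D x y true - pcondLaw D' x y true)) v
    rw [abs_sub_comm v]
    linarith
  · have := (isProper_ratioTest (D' := D') (y := y) hD hx m t).le_one hD true
    linarith

end RatioTest

variable {ι : Type*} [DecidableEq ι]

/-- Draw a sample `x` and, unless it is in the cell `l`, compare it with a uniform element `y` of
its cell. -/
noncomputable def pairTest (b : Fin N → ι) (l : ι) (D' : Fin N → ℝ) (m : ℕ) (t : ℝ) :
    PaircondAlg N :=
  samp fun x => if b x = l then output true else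
    randMem {y | b y = b x} fun y => ratioTest D' m t x y

/-- The mean of `g x y` for `x` drawn from `D` and `y` uniform in the cell of `x`, where pairs in
the cell `l` count as `0`. -/
noncomputable def pairMean (b : Fin N → ι) (l : ι) (D : Fin N → ℝ) (g : Fin N → Fin N → ℝ) : ℝ :=
  ∑ x, D x * if b x = l then 0 else
    (∑ y with b y = b x, g x y) / (Finset.card {y | b y = b x} : ℕ)

theorem cell_nonempty (b : Fin N → ι) (x : Fin N) :
    (Finset.univ.filter fun y => b y = b x).Nonempty :=
  ⟨x, by simp⟩

section PairTest

variable {D D' : Fin N → ℝ} {b : Fin N → ι} {l : ι}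

theorem queries_pairTest_le (b : Fin N → ι) (l : ι) (D' : Fin N → ℝ) (m : ℕ) (t : ℝ) :
    (pairTest b l D' m t).queries ≤ 1 + m := by
  simp only [pairTest, queries]
  refine Nat.add_le_add_left (Finset.sup_le fun x _ => ?_) 1
  split_ifs
  · exact Nat.zero_le _
  · exact queries_randMem_le _ fun y => queries_ratioTest_le _ _ _ _ _

theorem isProper_pairTest (hD : D ∈ stdSimplex ℝ (Fin N)) (m : ℕ) (t : ℝ) :
    IsProper D (pairTest b l D' m t) := by
  refine IsProper.samp hD fun x hx => ?_
  split_ifs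
  · exact IsProper.output D true
  · exact IsProper.randMem _ fun y _ => isProper_ratioTest hD.1 hx m t

theorem outProb_pairTest_self_ge (hD : D ∈ stdSimplex ℝ (Fin N)) (m : ℕ) {t : ℝ}
    (ht0 : 0 ≤ t) (ht : t ≤ 2) :
    1 - 2 * Real.exp (-(m * t ^ 2 / 4)) ≤ (pairTest b l D m t).outProb D true := by
  set η := 2 * Real.exp (-(m * t ^ 2 / 4))
  simp only [pairTest, outProb]
  calc 1 - η = ∑ x, D x * (1 - η) := by rw [← Finset.sum_mul, hD.2, one_mul]
    _ ≤ _ := by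
      refine Finset.sum_le_sum fun x _ => ?_
      rcases (hD.1 x).eq_or_lt with h0 | h0
      · simp [← h0]
      refine mul_le_mul_of_nonneg_left ?_ h0.le
      split_ifs
      · simp only [outProb, if_true]
        linarith [Real.exp_pos (-(m * t ^ 2 / 4))]
      · have hs := cell_nonempty b x
        rw [outProb_randMem D hs, le_div_iff₀ (by exact_mod_cast hs.card_pos), mul_comm,
          ← nsmul_eq_mul]
        exact Finset.card_nsmul_le_sum _ _ _ fun y _ =>
          outProb_ratioTest_self_ge hD.1 h0 m ht0 ht

theorem outProb_pairTest_true_le (hD : D ∈ stdSimplex ℝ (Fin N)) (hD' : ∀ x, b x ≠ l → 0 < D' x)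
    {m : ℕ} {t : ℝ} (ht0 : 0 < t) (ht : t ≤ 2) (hm : 2 * Real.exp (-(m * t ^ 2 / 4)) ≤ 1 / 2) :
    (pairTest b l D' m t).outProb D true
      ≤ 1 - 1 / 2 * pairMean b l D fun x y => if 2 * t ≤ pcondDev D D' x y then 1 else 0 := by
  simp only [pairTest, outProb, pairMean]
  rw [Finset.mul_sum]
  conv_rhs => enter [1]; rw [← hD.2]
  rw [← Finset.sum_sub_distrib]
  refine Finset.sum_le_sum fun x _ => ?_
  rcases (hD.1 x).eq_or_lt with h0 | h0
  · simp [← h0]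
  rw [mul_left_comm, ← mul_one_sub]
  refine mul_le_mul_of_nonneg_left ?_ h0.le
  split_ifs with hl
  · simp [outProb]
  · have hs := cell_nonempty b x
    have hc : (0 : ℝ) < (Finset.card {y | b y = b x} : ℕ) := by exact_mod_cast hs.card_pos
    rw [outProb_randMem D hs, div_le_iff₀ hc, sub_mul, one_mul, ← mul_div_assoc,
      div_mul_cancel₀ _ hc.ne', Finset.mul_sum, Finset.cast_card, ← Finset.sum_sub_distrib]
    exact Finset.sum_le_sum fun y _ => outProb_ratioTest_true_le hD.1 h0 (hD' x hl) ht0 ht hm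

theorem pairMean_mono (hD : ∀ i, 0 ≤ D i) {g h : Fin N → Fin N → ℝ} (hgh : ∀ x y, g x y ≤ h x y) :
    pairMean b l D g ≤ pairMean b l D h := by
  refine Finset.sum_le_sum fun x _ => mul_le_mul_of_nonneg_left ?_ (hD x)
  split_ifs
  · exact le_rfl
  · gcongr
    exact hgh _ _

theorem pairMean_add (g h : Fin N → Fin N → ℝ) :
    pairMean b l D (fun x y => g x y + h x y) = pairMean b l D g + pairMean b l D h := by
  rw [pairMean, pairMean, pairMean, ← Finset.sum_add_distrib]
  refine Finset.sum_congr rfl fun x _ => ?_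
  split_ifs
  · simp
  · rw [Finset.sum_add_distrib, add_div, mul_add]

theorem pairMean_const_mul (c : ℝ) (g : Fin N → Fin N → ℝ) :
    pairMean b l D (fun x y => c * g x y) = c * pairMean b l D g := by
  rw [pairMean, pairMean, Finset.mul_sum]
  refine Finset.sum_congr rfl fun x _ => ?_
  split_ifs
  · simp
  · rw [← Finset.mul_sum]; ring

theorem pairMean_sum {κ : Type*} (s : Finset κ) (g : κ → Fin N → Fin N → ℝ) :
    pairMean b l D (fun x y => ∑ k ∈ s, g k x y) = ∑ k ∈ s, pairMean b l D (g k) := by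
  classical
  induction s using Finset.induction_on with
  | empty => simp [pairMean]
  | insert a s ha ih => simp only [Finset.sum_insert ha, pairMean_add, ih]

theorem pairMean_const_le (hD : D ∈ stdSimplex ℝ (Fin N)) {c : ℝ} (hc : 0 ≤ c) :
    pairMean b l D (fun _ _ => c) ≤ c := by
  calc pairMean b l D (fun _ _ => c) ≤ ∑ x, D x * c := by
        refine Finset.sum_le_sum fun x _ => mul_le_mul_of_nonneg_left ?_ (hD.1 x)
        split_ifs
        · exact hc
        · have hs := cell_nonempty b x
          have : (0 : ℝ) < (Finset.card {y | b y = b x} : ℕ) := by exact_mod_cast hs.card_pos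
          rw [Finset.sum_const, nsmul_eq_mul, mul_div_cancel_left₀ _ this.ne']
    _ = c := by rw [← Finset.sum_mul, hD.2, one_mul]

/-- Dyadic pigeonhole: a bounded quantity with a large mean is large on some scale with
a correspondingly large probability. -/
theorem exists_pairMean_level_ge (hD : D ∈ stdSimplex ℝ (Fin N)) {g : Fin N → Fin N → ℝ}
    (hg : ∀ x y, g x y ≤ 1) {L : ℕ} {a : ℝ} (ha : (2 : ℝ)⁻¹ ^ L < a)
    (hmean : a ≤ pairMean b l D g) :
    ∃ j < L, (a - 2⁻¹ ^ L) / L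
      ≤ 2⁻¹ ^ j * pairMean b l D fun x y => if 2⁻¹ ^ (j + 1) ≤ g x y then 1 else 0 := by
  -- Layer decomposition: the largest dyadic scale below z already contributes at least z; if none
  -- is reached, z is below the remainder 2^(-L).
  have pt : ∀ (L : ℕ) (z : ℝ), z ≤ 1 →
      z ≤ 2⁻¹ ^ L + ∑ j ∈ Finset.range L, 2⁻¹ ^ j * if 2⁻¹ ^ (j + 1) ≤ z then 1 else 0 := by
    intro L z hz
    induction L with
    | zero => simpa using hz
    | succ L ih =>
      rw [Finset.sum_range_succ]
      split_ifs with h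
      · have : (0 : ℝ) < 2⁻¹ ^ (L + 1) := by positivity
        linarith
      · have : 0 ≤ ∑ j ∈ Finset.range L, (2⁻¹ : ℝ) ^ j * if 2⁻¹ ^ (j + 1) ≤ z then 1 else 0 :=
          Finset.sum_nonneg fun j _ => by positivity
        linarith
  have h := hmean.trans (pairMean_mono (b := b) (l := l) hD.1 fun x y => pt L _ (hg x y))
  rw [pairMean_add, pairMean_sum] at h
  simp only [pairMean_const_mul] at h
  have h1 := pairMean_const_le (b := b) (l := l) hD (c := 2⁻¹ ^ L) (by positivity)
  have hL : (0 : ℝ) < L := by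
    rcases Nat.eq_zero_or_pos L with rfl | h0
    · simp at h h1; simp at ha; linarith
    · exact_mod_cast h0
  by_contra! hcon
  have hne : (Finset.range L).Nonempty := by
    rw [Finset.nonempty_range_iff]; rintro rfl; simp at hL
  have h3 := Finset.sum_lt_sum_of_nonempty hne fun j hj => hcon j (Finset.mem_range.1 hj)
  rw [Finset.sum_const, Finset.card_range, nsmul_eq_mul, mul_div_cancel₀ _ hL.ne'] at h3
  linarith

end PairTest

/-! ### From Pcond deviations to l¹ distance. -/

section Symmetrization

variable {D Q : Fin N → ℝ}

/-- The deviation equals |D x Q y - Q x D y| / ((D x + D y)(Q x + Q y)). As `Q` is within a factor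
two of constant on `S`, |S| (Q x + Q y) is at most 4 times the mass of `S`. -/
theorem abs_mul_sub_mul_le (hD : ∀ i, 0 ≤ D i) {S : Finset (Fin N)} (hQ : ∀ x ∈ S, 0 < Q x)
    (hratio : ∀ x ∈ S, ∀ y ∈ S, Q x ≤ 2 * Q y) {x y : Fin N} (hx : x ∈ S) (hy : y ∈ S) :
    D x / (D x + D y) * |D x * Q y - Q x * D y|
      ≤ 4 * (∑ z ∈ S, Q z) * (D x * (pcondDev D Q x y / S.card)) := by
  rcases (hD x).eq_or_lt with h0 | h0
  · simp [← h0]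
  have hc : (0 : ℝ) < S.card := by exact_mod_cast Finset.card_pos.2 ⟨x, hx⟩
  have hDs : 0 < D x + D y := by linarith [hD y]
  have hQs : 0 < Q x + Q y := add_pos (hQ x hx) (hQ y hy)
  have bound : ∀ z ∈ S, S.card * Q z ≤ 2 * ∑ u ∈ S, Q u := by
    intro z hz
    rw [Finset.mul_sum, ← nsmul_eq_mul]
    exact Finset.card_nsmul_le_sum _ _ _ fun u hu => hratio z hz u hu
  have hdev : pcondDev D Q x y
      = |D x * Q y - Q x * D y| / ((D x + D y) * (Q x + Q y)) := by
    rw [pcondDev, pcondLaw, pcondLaw, div_sub_div _ _ hDs.ne' hQs.ne', abs_div,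
      abs_of_pos (mul_pos hDs hQs)]
    congr 2
    ring
  have h4 : 1 ≤ 4 * (∑ z ∈ S, Q z) / (S.card * (Q x + Q y)) := by
    rw [one_le_div (by positivity)]
    linarith [bound x hx, bound y hy]
  calc D x / (D x + D y) * |D x * Q y - Q x * D y|
      ≤ 4 * (∑ z ∈ S, Q z) / (S.card * (Q x + Q y))
        * (D x / (D x + D y) * |D x * Q y - Q x * D y|) :=
        le_mul_of_one_le_left (by positivity) h4
    _ = _ := by rw [hdev]; field_simp

/-- In a cell on which `Q` varies by a factor at most two, the mean deviation of the PCOND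
laws controls the distance between the conditional distributions. -/
theorem sum_abs_sub_le_sum_pcondDev (hD : ∀ i, 0 ≤ D i) {S : Finset (Fin N)}
    (hQ : ∀ x ∈ S, 0 < Q x) (hratio : ∀ x ∈ S, ∀ y ∈ S, Q x ≤ 2 * Q y) :
    ∑ x ∈ S, |D x - Q x| ≤ 8 * ∑ x ∈ S, D x * ((∑ y ∈ S, pcondDev D Q x y) / S.card)
      + |∑ x ∈ S, D x - ∑ x ∈ S, Q x| := by
  rcases S.eq_empty_or_nonempty with rfl | hS
  · simp
  set M := ∑ z ∈ S, Q z with hM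
  set P := ∑ z ∈ S, D z with hP
  have hM0 : 0 < M := Finset.sum_pos hQ hS
  set T := ∑ x ∈ S, ∑ y ∈ S, D x / (D x + D y) * |D x * Q y - Q x * D y| with hT
  have hT1 : T ≤ 4 * M * ∑ x ∈ S, D x * ((∑ y ∈ S, pcondDev D Q x y) / S.card) := by
    rw [Finset.mul_sum]
    refine Finset.sum_le_sum fun x hx => ?_
    rw [Finset.sum_div, Finset.mul_sum _ _ (D x), Finset.mul_sum _ _ (4 * M)]
    exact Finset.sum_le_sum fun y hy => abs_mul_sub_mul_le hD hQ hratio hx hy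
  -- Symmetrization: swapping x and y replaces the factor D x / (D x + D y) by its complement, so no
  -- regularity of `D` is needed.
  have hT2 : 2 * T = ∑ x ∈ S, ∑ y ∈ S, |D x * Q y - Q x * D y| := by
    have : T = ∑ x ∈ S, ∑ y ∈ S, D y / (D x + D y) * |D x * Q y - Q x * D y| := by
      rw [hT, Finset.sum_comm]
      refine Finset.sum_congr rfl fun x _ => Finset.sum_congr rfl fun y _ => ?_
      rw [add_comm (D y), abs_sub_comm, mul_comm (D y), mul_comm (Q y)]
    rw [two_mul]
    nth_rewrite 2 [this]
    rw [hT, ← Finset.sum_add_distrib]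
    refine Finset.sum_congr rfl fun x _ => ?_
    rw [← Finset.sum_add_distrib]
    refine Finset.sum_congr rfl fun y _ => ?_
    rw [← add_mul, ← add_div]
    rcases (add_nonneg (hD x) (hD y)).eq_or_lt with h | h
    · have h1 : D x = 0 := by linarith [hD x, hD y]
      have h2 : D y = 0 := by linarith [hD x, hD y]
      simp [h1, h2]
    · rw [div_self h.ne', one_mul]
  have hT3 : ∑ x ∈ S, |D x * M - Q x * P| ≤ 2 * T := by
    rw [hT2]
    refine Finset.sum_le_sum fun x _ => ?_
    rw [hM, hP, Finset.mul_sum, Finset.mul_sum, ← Finset.sum_sub_distrib]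
    exact Finset.abs_sum_le_sum_abs _ _
  have hsplit : M * ∑ x ∈ S, |D x - Q x| ≤ ∑ x ∈ S, |D x * M - Q x * P| + M * |P - M| := by
    have : M * |P - M| = ∑ x ∈ S, Q x * |P - M| := by rw [← Finset.sum_mul]
    rw [this, Finset.mul_sum, ← Finset.sum_add_distrib]
    refine Finset.sum_le_sum fun x hx => ?_
    calc M * |D x - Q x| = |(D x * M - Q x * P) + Q x * (P - M)| := by
          rw [← abs_of_pos hM0, ← abs_mul, abs_of_pos hM0]; congr 1; ring
      _ ≤ _ := by
          refine (abs_add_le _ _).trans ?_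
          rw [abs_mul (Q x), abs_of_pos (hQ x hx)]
  refine le_of_mul_le_mul_left (a := M) ?_ hM0
  rw [mul_add]
  linarith

variable [Fintype ι]

/-- Sum the cell estimate over all cells but `l`. In `l`, |D - Q| ≤ D + Q, and its `D`-mass is at
most its `Q`-mass plus the mass error. -/
theorem sum_abs_sub_le_pairMean (hD : ∀ i, 0 ≤ D i) (hQ0 : ∀ i, 0 ≤ Q i) (b : Fin N → ι) (l : ι)
    (hQ : ∀ x, b x ≠ l → 0 < Q x) (hratio : ∀ x y, b x ≠ l → b x = b y → Q x ≤ 2 * Q y) :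
    ∑ x, |D x - Q x| ≤ 8 * pairMean b l D (pcondDev D Q)
      + ∑ i, |pushWeight b D i - pushWeight b Q i| + 2 * pushWeight b Q l := by
  have hmean : pairMean b l D (pcondDev D Q) = ∑ i, if i = l then 0 else
      ∑ x with b x = i, D x * ((∑ y with b y = i, pcondDev D Q x y)
        / (Finset.card {y | b y = i} : ℕ)) := by
    rw [pairMean, ← Finset.sum_fiberwise (s := Finset.univ) (g := b)]
    refine Finset.sum_congr rfl fun i _ => ?_
    split_ifs with h
    · refine Finset.sum_eq_zero fun x hx => ?_
      rw [if_pos ((Finset.mem_filter.1 hx).2.trans h), mul_zero]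
    · refine Finset.sum_congr rfl fun x hx => ?_
      rw [(Finset.mem_filter.1 hx).2, if_neg h]
  have hlight : 2 * pushWeight b Q l = ∑ i, if i = l then 2 * pushWeight b Q i else 0 := by
    simp
  rw [hmean, hlight, Finset.mul_sum, ← Finset.sum_add_distrib, ← Finset.sum_add_distrib,
    ← Finset.sum_fiberwise (s := Finset.univ) (g := b)]
  refine Finset.sum_le_sum fun i _ => ?_
  split_ifs with h
  · have h1 : ∑ x with b x = i, |D x - Q x| ≤ pushWeight b D i + pushWeight b Q i := by
      rw [pushWeight, pushWeight, ← Finset.sum_add_distrib]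
      refine Finset.sum_le_sum fun x _ => ?_
      rw [abs_le]
      constructor <;> linarith [hD x, hQ0 x]
    linarith [le_abs_self (pushWeight b D i - pushWeight b Q i)]
  · rw [add_zero]
    refine sum_abs_sub_le_sum_pcondDev hD (fun x hx => hQ x ?_) fun x hx y hy =>
      hratio x y ?_ ?_
    · rwa [(Finset.mem_filter.1 hx).2]
    · rwa [(Finset.mem_filter.1 hx).2]
    · rw [(Finset.mem_filter.1 hx).2, (Finset.mem_filter.1 hy).2]

end Symmetrization

end PaircondAlg

/-! ### Union bound and the dyadic partition. -/

theorem one_sub_sum_le_prod_range {f : ℕ → ℝ} {η : ℝ} (n : ℕ) (h0 : ∀ i < n, 0 ≤ f i)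
    (h1 : ∀ i < n, f i ≤ 1) (h : ∀ i < n, 1 - η ≤ f i) :
    1 - n * η ≤ ∏ i ∈ Finset.range n, f i := by
  induction n with
  | zero => simp
  | succ n ih =>
    rw [Finset.prod_range_succ]
    have ih' := ih (fun i hi => h0 i (by omega)) (fun i hi => h1 i (by omega))
      fun i hi => h i (by omega)
    have hp : ∏ i ∈ Finset.range n, f i ≤ 1 :=
      Finset.prod_le_one (fun i hi => h0 i (by have := Finset.mem_range.1 hi; omega))
        fun i hi => h1 i (by have := Finset.mem_range.1 hi; omega)
    have a0 := h0 n (by omega)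
    have a1 := h1 n (by omega)
    have a2 := h n (by omega)
    push_cast
    nlinarith

theorem exists_dyadic_level (K : ℕ) {q : ℝ} (hq : q ≤ 1) :
    ∃ k ≤ K, q ≤ 2⁻¹ ^ k ∧ (k = K ∨ 2⁻¹ ^ (k + 1) < q) := by
  induction K with
  | zero => exact ⟨0, le_rfl, by simpa using hq, Or.inl rfl⟩
  | succ K ih =>
    obtain ⟨k, hk, hqk, rfl | h⟩ := ih
    · by_cases h : 2⁻¹ ^ (k + 1) < q
      · exact ⟨k, by omega, hqk, Or.inr h⟩
      · exact ⟨k + 1, le_rfl, not_lt.1 h, Or.inl rfl⟩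
    · exact ⟨k, by omega, hqk, Or.inr h⟩

/-- Partition into `K` dyadic cells and one cell of light elements. -/
theorem exists_dyadic_cells {N : ℕ} (K : ℕ) {Q : Fin N → ℝ} (hQ : Q ∈ stdSimplex ℝ (Fin N)) :
    ∃ b : Fin N → Fin (K + 1), (∀ x, b x ≠ Fin.last K → 0 < Q x) ∧
      (∀ x y, b x ≠ Fin.last K → b x = b y → Q x ≤ 2 * Q y) ∧
      pushWeight b Q (Fin.last K) ≤ N * 2⁻¹ ^ K := by
  have hle : ∀ x, Q x ≤ 1 := fun x => by
    rw [← hQ.2]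
    exact Finset.single_le_sum (fun i _ => hQ.1 i) (Finset.mem_univ x)
  choose k hkK hupper hlower using fun x => exists_dyadic_level K (hle x)
  have hlow : ∀ x, (⟨k x, Nat.lt_succ_of_le (hkK x)⟩ : Fin (K + 1)) ≠ Fin.last K →
      2⁻¹ ^ (k x + 1) < Q x := fun x hx =>
    (hlower x).resolve_left fun h => hx (Fin.ext h)
  refine ⟨fun x => ⟨k x, Nat.lt_succ_of_le (hkK x)⟩, fun x hx => ?_, fun x y hx hxy => ?_, ?_⟩
  · exact lt_trans (by positivity) (hlow x hx)
  · have h := hlow y fun hy => hx (hxy.trans hy)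
    have hk : k x = k y := congrArg Fin.val hxy
    have h1 := hupper x
    rw [hk] at h1
    rw [pow_succ] at h
    linarith
  · calc pushWeight _ Q (Fin.last K)
        ≤ ∑ x with (⟨k x, Nat.lt_succ_of_le (hkK x)⟩ : Fin (K + 1)) = Fin.last K,
            (2⁻¹ : ℝ) ^ K := by
          refine Finset.sum_le_sum fun x hx => ?_
          have : k x = K := congrArg Fin.val (Finset.mem_filter.1 hx).2
          rw [← this]
          exact hupper x
      _ ≤ ∑ _x : Fin N, (2⁻¹ : ℝ) ^ K :=
          Finset.sum_le_sum_of_subset_of_nonneg (Finset.subset_univ _)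
            fun _ _ _ => by positivity
      _ = _ := by simp

/-! ### The fine test over all scales. -/

namespace PaircondAlg

variable {N : ℕ} {ι : Type*} [DecidableEq ι]

/-- The pair tests of all scales `2⁻¹ ^ (j + 1)`, `j < L`, repeated sufficiently often. -/
noncomputable def scalesTest (b : Fin N → ι) (l : ι) (D' : Fin N → ℝ) (L : ℕ) : PaircondAlg N :=
  -- Seeing a deviation 2^(-j-1) takes about 4^j queries. At the good scale it occurs with
  -- probability at least 2^(j-L)/L, so about L 2^(L-j) pairs find it. The extra factor `L` in the
  -- queries per pair pays for the union bound.
  seqRange (fun j => seqRange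
    (fun _ => pairTest b l D' (640 * L * 4 ^ j) (2⁻¹ ^ (j + 1) / 2)) (4 * L * 2 ^ (L - j))) L

section ScalesTest

variable {D D' : Fin N → ℝ} {b : Fin N → ι} {l : ι} {L : ℕ}

theorem queries_scalesTest_le (b : Fin N → ι) (l : ι) (D' : Fin N → ℝ) (L : ℕ) :
    (scalesTest b l D' L).queries ≤ 2564 * L ^ 3 * 4 ^ L := by
  refine (queries_seqRange_le _ _).trans ?_
  have h : ∀ j ∈ Finset.range L, (seqRange
      (fun _ => pairTest b l D' (640 * L * 4 ^ j) (2⁻¹ ^ (j + 1) / 2))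
        (4 * L * 2 ^ (L - j))).queries ≤ 2564 * L ^ 2 * 4 ^ L := by
    intro j hj
    have hjL := Finset.mem_range.1 hj
    refine (queries_seqRange_le _ _).trans ?_
    rw [Finset.sum_const, Finset.card_range, smul_eq_mul]
    have h1 : 1 ≤ L * 4 ^ j := Nat.mul_pos (by omega) (by positivity)
    have h2 : 2 ^ (L - j) * 4 ^ j ≤ 4 ^ L := by
      calc 2 ^ (L - j) * 4 ^ j ≤ 4 ^ (L - j) * 4 ^ j := by gcongr; norm_num
        _ = 4 ^ L := by rw [← pow_add]; congr 1; omega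
    calc _ ≤ 4 * L * 2 ^ (L - j) * (L * 4 ^ j + 640 * L * 4 ^ j) :=
          Nat.mul_le_mul_left _ ((queries_pairTest_le _ _ _ _ _).trans (by omega))
      _ = 2564 * L ^ 2 * (2 ^ (L - j) * 4 ^ j) := by ring
      _ ≤ _ := by gcongr
  refine (Finset.sum_le_card_nsmul _ _ _ h).trans (le_of_eq ?_)
  rw [Finset.card_range, smul_eq_mul]
  ring

theorem isProper_scalesTest (hD : D ∈ stdSimplex ℝ (Fin N)) :
    IsProper D (scalesTest b l D' L) :=
  IsProper.seqRange (fun _ => IsProper.seqRange (fun _ => isProper_pairTest hD _ _) _) _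

theorem scale_exponent (L j : ℕ) :
    ((640 * L * 4 ^ j : ℕ) : ℝ) * ((2 : ℝ)⁻¹ ^ (j + 1) / 2) ^ 2 / 4 = 10 * L := by
  have : (4 : ℝ) ^ j * ((2 : ℝ)⁻¹ ^ j) ^ 2 = 1 := by
    rw [← pow_mul, mul_comm j 2, pow_mul, ← mul_pow]
    norm_num
  push_cast
  rw [pow_succ]
  linear_combination 10 * L * this

theorem exp_scale_le (L : ℕ) : Real.exp (-(10 * L)) ≤ 2⁻¹ ^ (10 * L) := by
  have h : Real.exp (-1) ≤ 2⁻¹ := by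
    rw [Real.exp_neg]
    gcongr
    linarith [Real.add_one_le_exp (1 : ℝ)]
  calc Real.exp (-(10 * L)) = Real.exp (-1) ^ (10 * L) := by
        rw [← Real.exp_nat_mul]; push_cast; ring_nf
    _ ≤ _ := pow_le_pow_left₀ (Real.exp_pos _).le h _

theorem scale_le_two (j : ℕ) : (2 : ℝ)⁻¹ ^ (j + 1) / 2 ≤ 2 := by
  have : (2 : ℝ)⁻¹ ^ (j + 1) ≤ 1 := pow_le_one₀ (by norm_num) (by norm_num)
  linarith

theorem outProb_scalesTest_self_ge (hD : D ∈ stdSimplex ℝ (Fin N)) :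
    15 / 16 ≤ (scalesTest b l D L).outProb D true := by
  rcases Nat.eq_zero_or_pos L with rfl | hL
  · simp only [scalesTest, seqRange, outProb, if_true]; norm_num
  set η := 2 * Real.exp (-(10 * L)) with hη
  have hη0 : 0 < η := by positivity
  rw [scalesTest, outProb_seqRange_true]
  have hle : ∀ A : PaircondAlg N, IsProper D A → 0 ≤ A.outProb D true ∧ A.outProb D true ≤ 1 :=
    fun A hA => ⟨outProb_nonneg hD.1 A true, hA.le_one hD.1 true⟩
  have hpair : ∀ m t, IsProper D (pairTest b l D m t) := fun m t => isProper_pairTest hD m t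
  have inner : ∀ j < L, 1 - 4 * L * 2 ^ L * η ≤ (seqRange
      (fun _ => pairTest b l D (640 * L * 4 ^ j) (2⁻¹ ^ (j + 1) / 2))
        (4 * L * 2 ^ (L - j))).outProb D true := by
    intro j _
    rw [outProb_seqRange_true]
    refine le_trans ?_ (one_sub_sum_le_prod_range (η := η) _ (fun _ _ => (hle _ (hpair _ _)).1)
      (fun _ _ => (hle _ (hpair _ _)).2) fun _ _ => ?_)
    · push_cast
      gcongr
      · norm_num
      · omega
    · have := outProb_pairTest_self_ge (b := b) (l := l) hD (640 * L * 4 ^ j)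
        (t := 2⁻¹ ^ (j + 1) / 2) (by positivity) (scale_le_two j)
      rwa [scale_exponent] at this
  refine le_trans ?_ (one_sub_sum_le_prod_range L
    (fun j _ => (hle _ (IsProper.seqRange (fun _ => hpair _ _) _)).1)
    (fun j _ => (hle _ (IsProper.seqRange (fun _ => hpair _ _) _)).2) inner)
  have hLpow : (L : ℝ) ≤ 2 ^ L := by exact_mod_cast Nat.lt_two_pow_self.le
  -- Union bound over at most 4 L² 2^L pair tests, using L ≤ 2^L; the result 8 · 128^(-L) is at most
  -- 1/16.
  have h1 : (L : ℝ) * (4 * L * 2 ^ L * η) ≤ 8 * ((2 : ℝ) ^ L) ^ 3 * 2⁻¹ ^ (10 * L) := by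
    calc (L : ℝ) * (4 * L * 2 ^ L * η)
        ≤ 2 ^ L * (4 * 2 ^ L * 2 ^ L * (2 * 2⁻¹ ^ (10 * L))) := by
          rw [hη]; gcongr; exact exp_scale_le L
      _ = _ := by ring
  have h2 : ((2 : ℝ) ^ L) ^ 3 * 2⁻¹ ^ (10 * L) = (128⁻¹ : ℝ) ^ L := by
    rw [pow_mul, ← pow_mul, mul_comm L 3, pow_mul, ← mul_pow]; norm_num
  have h3 : (128⁻¹ : ℝ) ^ L ≤ 128⁻¹ := pow_le_of_le_one (by norm_num) (by norm_num) hL.ne'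
  rw [mul_assoc 8, h2] at h1
  linarith

theorem outProb_scalesTest_true_le (hD : D ∈ stdSimplex ℝ (Fin N))
    (hD' : ∀ x, b x ≠ l → 0 < D' x) (hdev1 : ∀ x y, pcondDev D D' x y ≤ 1)
    (hdev : 2 * 2⁻¹ ^ L ≤ pairMean b l D (pcondDev D D')) :
    (scalesTest b l D' L).outProb D true ≤ 1 / 3 := by
  have hpos : (0 : ℝ) < 2⁻¹ ^ L := by positivity
  obtain ⟨j, hj, h⟩ := exists_pairMean_level_ge hD hdev1 (L := L) (a := 2 * 2⁻¹ ^ L)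
    (by linarith) hdev
  set q := pairMean b l D fun x y => if 2⁻¹ ^ (j + 1) ≤ pcondDev D D' x y then 1 else 0 with hq
  have hL : (1 : ℝ) ≤ L := by exact_mod_cast (by omega : 1 ≤ L)
  set m := 640 * L * 4 ^ j with hm
  set t : ℝ := 2⁻¹ ^ (j + 1) / 2 with ht
  have hprob : (pairTest b l D' m t).outProb D true ≤ Real.exp (-(q / 2)) := by
    have h1 := outProb_pairTest_true_le (m := m) hD hD' (t := t) (by positivity) (scale_le_two j)
      (by
        rw [hm, ht, scale_exponent]
        have h2 : (2 : ℝ)⁻¹ ^ (10 * L) ≤ 2⁻¹ ^ 2 :=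
          pow_le_pow_of_le_one (by norm_num) (by norm_num) (by omega)
        have := exp_scale_le L
        norm_num at h2 this ⊢
        linarith)
    have h2 : 2 * t = 2⁻¹ ^ (j + 1) := by rw [ht]; ring
    rw [h2, ← hq] at h1
    linarith [Real.add_one_le_exp (-(q / 2))]
  -- At least four bad pairs are expected at scale `j`, each caught with probability at least 1/2:
  -- survival has probability at most exp(-2).
  have hs : 4 ≤ (4 * L * 2 ^ (L - j) : ℕ) * q := by
    have e1 : (2 : ℝ)⁻¹ ^ L * 2 ^ (L - j) = 2⁻¹ ^ j := by
      have : L = (L - j) + j := by omega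
      nth_rewrite 1 [this]
      rw [pow_add, mul_right_comm, ← mul_pow]
      norm_num
    have e2 : (2 : ℝ)⁻¹ ^ L ≤ L * (2⁻¹ ^ j * q) := by
      rw [div_le_iff₀ (by linarith)] at h
      linarith
    have e3 : (2 : ℝ)⁻¹ ^ L * 1 ≤ 2⁻¹ ^ L * (L * 2 ^ (L - j) * q) := by
      calc (2 : ℝ)⁻¹ ^ L * 1 ≤ L * (2⁻¹ ^ j * q) := by rwa [mul_one]
        _ = _ := by rw [← e1]; ring
    have e4 := le_of_mul_le_mul_left e3 hpos
    push_cast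
    linarith
  have hle : ∀ A : PaircondAlg N, IsProper D A → 0 ≤ A.outProb D true ∧ A.outProb D true ≤ 1 :=
    fun A hA => ⟨outProb_nonneg hD.1 A true, hA.le_one hD.1 true⟩
  have hprop : ∀ j, IsProper D (seqRange
      (fun _ => pairTest b l D' (640 * L * 4 ^ j) (2⁻¹ ^ (j + 1) / 2)) (4 * L * 2 ^ (L - j))) :=
    fun j => IsProper.seqRange (fun _ => isProper_pairTest hD _ _) _
  rw [scalesTest, outProb_seqRange_true,
    ← Finset.mul_prod_erase _ _ (Finset.mem_range.2 hj)]
  refine (mul_le_of_le_one_right (hle _ (hprop j)).1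
    (Finset.prod_le_one (fun i _ => (hle _ (hprop i)).1) fun i _ => (hle _ (hprop i)).2)).trans ?_
  rw [outProb_seqRange_true, Finset.prod_const, Finset.card_range]
  calc _ ≤ Real.exp (-(q / 2)) ^ (4 * L * 2 ^ (L - j)) :=
        pow_le_pow_left₀ (outProb_nonneg hD.1 _ _) hprob _
    _ = Real.exp (-((4 * L * 2 ^ (L - j) : ℕ) * q / 2)) := by
        rw [← Real.exp_nat_mul]; congr 1; ring
    _ ≤ Real.exp (-2) := Real.exp_le_exp.2 (by linarith)
    _ ≤ 1 / 3 := by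
        rw [Real.exp_neg, ← one_div]
        gcongr
        linarith [Real.add_one_le_exp (2 : ℝ)]

end ScalesTest

theorem pcondDev_le_one {D D' : Fin N → ℝ} (hD : ∀ i, 0 ≤ D i) (hD' : ∀ i, 0 ≤ D' i)
    (x y : Fin N) : pcondDev D D' x y ≤ 1 := by
  have h : ∀ E : Fin N → ℝ, (∀ i, 0 ≤ E i) → 0 ≤ pcondLaw E x y true ∧ pcondLaw E x y true ≤ 1 :=
    fun E hE => ⟨pcondLaw_nonneg hE x y true,
      div_le_one_of_le₀ (by linarith [hE y]) (add_nonneg (hE x) (hE y))⟩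
  rw [pcondDev, abs_le]
  constructor <;> linarith [(h D hD).1, (h D hD).2, (h D' hD').1, (h D' hD').2]

/-! ### Assembling the tester and counting queries. -/

theorem exists_identityTester {Q : Fin N → ℝ} (hQ : Q ∈ stdSimplex ℝ (Fin N)) {ε : ℝ} (hε : 0 < ε)
    (hε1 : ε ≤ 1) {K L n : ℕ} (hL : 16 / ε ≤ 2 ^ L) (hK : N * 2 ^ L ≤ 2 ^ K)
    (hn : 512 * √(K + 1) ≤ n * ε ^ 2) :
    ∃ A : PaircondAlg N, A.queries ≤ 2 * n + 2564 * L ^ 3 * 4 ^ L ∧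
      ∀ D ∈ stdSimplex ℝ (Fin N), (D = Q → 2 / 3 ≤ A.outProb D true) ∧
        (ε ≤ tvDist D Q → 2 / 3 ≤ A.outProb D false) := by
  obtain ⟨b, hpos, hratio, hlight⟩ := exists_dyadic_cells K hQ
  have hQb : pushWeight b Q ∈ stdSimplex ℝ (Fin (K + 1)) :=
    ⟨pushWeight_nonneg hQ.1 b, by rw [sum_pushWeight, hQ.2]⟩
  obtain ⟨A, hA, hAD⟩ := exists_cellTest b hQb hε hε1 (n := n) (by simpa using hn)
  have h2L : (2 : ℝ)⁻¹ ^ L ≤ ε / 16 := by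
    rw [inv_pow]
    calc ((2 : ℝ) ^ L)⁻¹ ≤ (16 / ε)⁻¹ := by gcongr
      _ = ε / 16 := inv_div _ _
  have hlight' : pushWeight b Q (Fin.last K) ≤ ε / 16 := by
    refine hlight.trans (le_trans ?_ h2L)
    have : (N : ℝ) * 2 ^ L ≤ 2 ^ K := by exact_mod_cast hK
    rw [inv_pow, inv_pow, ← div_eq_mul_inv, div_le_iff₀ (by positivity), inv_mul_eq_div,
      le_div_iff₀ (by positivity)]
    exact this
  refine ⟨A.seq (scalesTest b (Fin.last K) Q L), (queries_seq_le _ _).trans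
    (add_le_add hA (queries_scalesTest_le _ _ _ _)), fun D hD => ⟨?_, fun hfar => ?_⟩⟩
  · rintro rfl
    rw [outProb_seq_true]
    have h1 := (hAD D hD).2.1 rfl
    have h2 := outProb_scalesTest_self_ge (b := b) (l := Fin.last K) (L := L) hD
    calc (2 : ℝ) / 3 ≤ 9 / 10 * (15 / 16) := by norm_num
      _ ≤ _ := by gcongr
  · have hp1 := (hAD D hD).1
    have hp2 := isProper_scalesTest (b := b) (l := Fin.last K) (D' := Q) (L := L) hD
    have hp := hp1.seq hp2
    have htrue : (A.seq (scalesTest b (Fin.last K) Q L)).outProb D true ≤ 1 / 3 := by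
      rw [outProb_seq_true]
      by_cases hcell : ε / 2 ≤ ∑ i, |pushWeight b D i - pushWeight b Q i|
      · exact (mul_le_of_le_one_right (outProb_nonneg hD.1 _ _) (hp2.le_one hD.1 true)).trans
          ((hAD D hD).2.2 hcell)
      · refine (mul_le_of_le_one_left (outProb_nonneg hD.1 _ _) (hp1.le_one hD.1 true)).trans
          (outProb_scalesTest_true_le hD hpos (pcondDev_le_one hD.1 hQ.1) ?_)
        -- The l¹ distance is at least 2ε; the masses account for less than ε/2 and the light cell
        -- for at most ε/8. The mean deviation thus exceeds 11ε/64, hence ε/8 ≥ 2 · 2^(-L).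
        have h := sum_abs_sub_le_pairMean hD.1 hQ.1 b (Fin.last K) hpos hratio
        rw [tvDist] at hfar
        linarith
    unfold IsProper at hp
    linarith

end PaircondAlg

theorem tvDist_le_one {N : ℕ} {D D' : Fin N → ℝ} (hD : D ∈ stdSimplex ℝ (Fin N))
    (hD' : D' ∈ stdSimplex ℝ (Fin N)) : tvDist D D' ≤ 1 := by
  have : ∑ i, |D i - D' i| ≤ ∑ i, (D i + D' i) := Finset.sum_le_sum fun i _ => by
    rw [abs_le]
    constructor <;> linarith [hD.1 i, hD'.1 i]
  rw [Finset.sum_add_distrib, hD.2, hD'.2] at this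
  rw [tvDist]
  linarith

theorem tvDist_eq_zero_of_le_one {N : ℕ} (hN : N ≤ 1) {D D' : Fin N → ℝ}
    (hD : D ∈ stdSimplex ℝ (Fin N)) (hD' : D' ∈ stdSimplex ℝ (Fin N)) : tvDist D D' = 0 := by
  interval_cases N
  · simp [tvDist]
  · have h := hD.2
    have h' := hD'.2
    simp only [Fin.sum_univ_one] at h h'
    simp [tvDist, h, h']

/-- The number of queries of the identity tester in terms of `f = √(log N) / ε ^ 2`. -/
theorem query_bound {N : ℕ} (hN : 2 ≤ N) {ε : ℝ} (hε : 0 < ε) (hε1 : ε ≤ 1) {L : ℕ}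
    (hL : (2 : ℝ) ^ L ≤ 32 / ε) :
    ((2 * ⌈512 * √((Nat.clog 2 N + L : ℕ) + 1) / ε ^ 2⌉₊ + 2564 * L ^ 3 * 4 ^ L : ℕ) : ℝ)
      ≤ 10 ^ 10 * (√(Real.log N) * (ε ^ 2)⁻¹)
        * Real.log (2 + √(Real.log N) * (ε ^ 2)⁻¹) ^ 3 := by
  set e := (ε ^ 2)⁻¹ with he
  set r := √(Real.log N) with hr
  set Λ := Real.log (2 + r * e) with hΛ
  have hlog2 := Real.log_two_gt_d9
  have hlog2' := Real.log_two_lt_d9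
  have he1 : 1 ≤ e := (one_le_inv₀ (by positivity)).2 (pow_le_one₀ hε.le hε1)
  have hlogN : Real.log 2 ≤ Real.log N := Real.log_le_log (by norm_num) (by exact_mod_cast hN)
  have hr2 : r ^ 2 = Real.log N := Real.sq_sqrt (by linarith)
  -- As N ≥ 2, `r` is bounded below, so `r * e` controls `e` alone; 2 + 4/5 > exp 1 then gives Λ ≥
  -- 1.
  have hr08 : 4 / 5 ≤ r := Real.le_sqrt_of_sq_le (by norm_num; linarith)
  have hf : 4 / 5 * e ≤ r * e := by gcongr
  have hΛ1 : 1 ≤ Λ := by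
    rw [hΛ, Real.le_log_iff_exp_le (by linarith)]
    linarith [Real.exp_one_lt_d9]
  have hloge : Real.log e ≤ Real.log 2 + Λ := by
    rw [hΛ, ← Real.log_mul (by norm_num) (by linarith)]
    exact Real.log_le_log (by linarith) (by linarith)
  have hLΛ : (L : ℝ) ≤ 7 * Λ := by
    have h1 : L * Real.log 2 ≤ 5 * Real.log 2 + Real.log e / 2 := by
      have h2 := Real.log_le_log (by positivity) hL
      rw [Real.log_pow, Real.log_div (by norm_num) hε.ne',
        show (32 : ℝ) = 2 ^ 5 by norm_num, Real.log_pow] at h2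
      rw [he, Real.log_inv, Real.log_pow]
      push_cast at h2 ⊢
      linarith
    nlinarith
  have h4L : (4 : ℝ) ^ L ≤ 1024 * e := by
    calc (4 : ℝ) ^ L = (2 ^ L) ^ 2 := by rw [← pow_mul, mul_comm, pow_mul]; norm_num
      _ ≤ (32 / ε) ^ 2 := by gcongr
      _ = _ := by rw [he, div_pow]; ring
  have hclog : (Nat.clog 2 N : ℝ) ≤ 3 / 2 * r ^ 2 + 1 := by
    have h1 : 2 ^ (Nat.clog 2 N - 1) < N := Nat.pow_pred_clog_lt_self (by norm_num) (by omega)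
    have h2 : ((2 : ℝ) ^ (Nat.clog 2 N - 1)) ≤ N := by exact_mod_cast h1.le
    have h3 := Real.log_le_log (by positivity) h2
    rw [Real.log_pow, ← hr2] at h3
    have h4 : (Nat.clog 2 N : ℝ) ≤ (Nat.clog 2 N - 1 : ℕ) + 1 := by
      exact_mod_cast (by omega : Nat.clog 2 N ≤ Nat.clog 2 N - 1 + 1)
    have h5 : (0 : ℝ) ≤ (Nat.clog 2 N - 1 : ℕ) := Nat.cast_nonneg _
    nlinarith
  -- A sum of r² and Λ terms is bounded by a multiple of the product r² Λ², since both factors are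
  -- bounded below.
  have hsqrt : √((Nat.clog 2 N + L : ℕ) + 1) ≤ 4 * r * Λ := by
    rw [Real.sqrt_le_iff]
    refine ⟨by positivity, ?_⟩
    push_cast
    have h1 : Λ ≤ Λ ^ 2 := by nlinarith
    have h2 : 16 / 25 ≤ r ^ 2 := by nlinarith
    have h3 : 16 / 25 * Λ ^ 2 ≤ r ^ 2 * Λ ^ 2 := by gcongr
    have h4 : r ^ 2 * 1 ≤ r ^ 2 * Λ ^ 2 := by gcongr; linarith
    nlinarith
  have hceil : (⌈512 * √((Nat.clog 2 N + L : ℕ) + 1) / ε ^ 2⌉₊ : ℝ) ≤ 2048 * (r * e) * Λ + 1 := by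
    refine (Nat.ceil_lt_add_one (by positivity)).le.trans ?_
    rw [div_eq_mul_inv, ← he]
    have : 512 * √((Nat.clog 2 N + L : ℕ) + 1) * e ≤ 512 * (4 * r * Λ) * e := by gcongr
    linarith
  have hL3 : (L : ℝ) ^ 3 * 4 ^ L ≤ (7 * Λ) ^ 3 * (1024 * (5 / 4 * (r * e))) := by
    gcongr
    exact h4L.trans (by linarith)
  have hΛ3 : r * e * Λ ≤ r * e * Λ ^ 3 := by
    gcongr
    exact le_self_pow₀ hΛ1 (by norm_num)
  have hΛ4 : 4 / 5 ≤ r * e * Λ ^ 3 := by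
    have : (1 : ℝ) ≤ Λ ^ 3 := one_le_pow₀ hΛ1
    nlinarith
  push_cast
  push_cast at hceil
  nlinarith

theorem theorem4 :
    ∃ (C : ℝ) (k : ℕ),
      ∀ (N : ℕ) (Dstar : Fin N → ℝ), Dstar ∈ stdSimplex ℝ (Fin N) →
      ∀ ε : ℝ, 0 < ε →
      ∃ A : PaircondAlg N,
        (A.queries : ℝ) ≤
          C * (√(Real.log N) * (ε ^ 2)⁻¹) *
            Real.log (2 + √(Real.log N) * (ε ^ 2)⁻¹) ^ k ∧
        ∀ D : Fin N → ℝ, D ∈ stdSimplex ℝ (Fin N) →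
          (D = Dstar → 2 / 3 ≤ A.outProb D true) ∧
          (ε ≤ tvDist D Dstar → 2 / 3 ≤ A.outProb D false) := by
  refine ⟨10 ^ 10, 3, fun N Q hQ ε hε => ?_⟩
  by_cases h : 2 ≤ N ∧ ε ≤ 1
  · obtain ⟨hN, hε1⟩ := h
    obtain ⟨L, hL1, hL2⟩ := exists_nat_pow_near (x := 16 / ε) (y := 2)
      ((one_le_div hε).2 (by linarith)) (by norm_num)
    have hK : N * 2 ^ (L + 1) ≤ 2 ^ (Nat.clog 2 N + (L + 1)) := by
      rw [pow_add 2 (Nat.clog 2 N)]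
      exact Nat.mul_le_mul_right _ (Nat.le_pow_clog one_lt_two N)
    obtain ⟨A, hA, hAD⟩ := PaircondAlg.exists_identityTester hQ hε hε1 hL2.le hK
      (n := ⌈512 * √((Nat.clog 2 N + (L + 1) : ℕ) + 1) / ε ^ 2⌉₊) (by
        rw [← div_le_iff₀ (by positivity)]
        exact Nat.le_ceil _)
    refine ⟨A, le_trans (by exact_mod_cast hA) (query_bound hN hε hε1 (L := L + 1) ?_), hAD⟩
    rw [pow_succ, show (32 : ℝ) / ε = 16 / ε * 2 by ring]
    gcongr
  -- For N ≤ 1 the query budget is zero, and for ε > 1 nothing is far. In both cases the far case is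
  -- empty, so accepting outright is correct.
  · refine ⟨.output true, ?_, fun D hD => ⟨fun _ => ?_, fun hfar => ?_⟩⟩
    · have h1 : 0 ≤ √(Real.log N) * (ε ^ 2)⁻¹ := by positivity
      have h2 := Real.log_nonneg (by linarith : 1 ≤ 2 + √(Real.log N) * (ε ^ 2)⁻¹)
      simp only [PaircondAlg.queries, Nat.cast_zero]
      positivity
    · simp only [PaircondAlg.outProb, if_true]
      norm_num
    · rcases not_and_or.1 h with h | h
      · linarith [tvDist_eq_zero_of_le_one (by omega) hD hQ]
      · linarith [tvDist_le_one hD hQ]
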